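/- **Setting.** Let $d \ge 2$. For $N \ge 1$ let ${\mathbb T} = ({\mathbb Z}/N{\mathbb Z})^d$ and let $E = {\mathbb T}\times{\mathbb Z}$ be the discrete cylinder. For $x\in E$ let $P_x$ be the canonical law on $E^{\mathbb N}$ of simple random walk on $E$ started at $x$ (each step is one of the $2(d+1)$ signed unit vectors, chosen uniformly). Write $X_\cdot=(Y_\cdot,Z_\cdot)$ for the canonical process and its ${\mathbb T}$- and ${\mathbb Z}$-components, $\nu_z$ for the uniform distribution on ${\mathbb T}\times\{z\}$, $P_{\nu_z}=\int d\nu_z(x)\,P_x$, and $P=P_{\nu_0}$. Let $M\ge 1$ and let $z_1(N),\dots,z_M(N)$ be sequences of integers (the vertical components of $M$ given points of $E$) with $\lim_N z_i(N)/N^d = v_i\in{\mathbb R}$ for $1\le i\le M$. Let $(h_N)$, $(d_N)$ be sequences of non-negative integers tending to infinity such that $$h_N=o(N^d),\qquad h_N\ge N(\log N)^2 \text{ for large } N,\qquad d_N=o(h_N),\qquad 1+\max_{i,j:\,v_i=v_j}|z_i(N)-z_j(N)| = o(d_N).$$ Define the grid ${\cal G}={\cal G}^*\cup{\cal G}^0$,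 where ${\cal G}^*$ consists of the points $\max\{z_j(N);\, v_j=w\}$ as $w$ runs over the distinct values among $v_1,\dots,v_M$, and ${\cal G}^0=\{z\in 2h_N{\mathbb Z};\ |z-z^*|\ge 2h_N \text{ for all } z^*\in{\cal G}^*\}$. Put $C={\cal G}+[-d_N,d_N]$ and $O={\cal G}+(-h_N,h_N)$. With $D_0=0$, define for $k\ge 0$ the successive return and departure times $$R_{k+1}=\inf\{n\ge D_k;\ Z_n\in C\},\qquad D_{k+1}=\inf\{n\ge R_{k+1};\ Z_n\notin O\}.$$ For $z,z'\in{\mathbb Z}$ with $P_{\nu_z}[Z_{D_1}=z']>0$ let $P_{z,z'}=P_{\nu_z}[\,\cdot\mid Z_{D_1}=z']$. **Proposition 3.3.** There is a constant $c>0$ depending only on $d$ such that, for all data as above, for all large $N$ one can construct on some probability space $(\widetilde\Omega,\widetilde{\cal A},\widetilde P)$ a ${\mathbb Z}$-valued process $Z_\cdot$ and ${\mathbb T}$-valued processes $Y_\cdot$ and $\widetilde Y^k_\cdot$, $k\ge 2$, such that, with $R_k$, $D_k$ now computed from this $Z_\cdot$: 1. $X_\cdot=(Y_\cdot,Z_\cdot)$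 has the same law under $\widetilde P$ as the walk on $E$ under $P$. 2. Under $\widetilde P$, conditionally on $Z_{\cdot\wedge D_1}$ and $Z_{R_k},Z_{D_k}$, $k\ge 2$, the processes $\widetilde X^k_\cdot=(\widetilde Y^k_\cdot,\,Z_{(R_k+\cdot)\wedge D_k})$, $k\ge 2$, are independent, and $\widetilde X^k_\cdot$ has the law of $X_{\cdot\wedge D_1}$ under $P_{Z_{R_k},Z_{D_k}}$. 3. $\widetilde P\big[\,Y_{(R_k+\cdot)\wedge D_k}\ne\widetilde Y^k_\cdot\,\big]\le c\,N^{-3d}$ for every $k\ge 2$. -/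

import Mathlib

open Filter Topology Asymptotics MeasureTheory ProbabilityTheory

namespace CylinderWalk

noncomputable section

/-- The torus `𝕋 = (ℤ/Nℤ)^d`. -/
abbrev Torus (d N : ℕ) : Type := Fin d → ZMod N

/-- The discrete cylinder `E = 𝕋 × ℤ`. -/
abbrev Cyl (d N : ℕ) : Type := Torus d N × ℤ

/-! ### Simple random walk on the cylinder -/

/-- The `2 (d + 1)` signed unit vectors of the cylinder: `(some i, s)` is `± e_i` in the torus
direction `i`, and `(none, s)` is `± 1` in the vertical direction. -/
def unitStep (d N : ℕ) : Option (Fin d) × Bool → Cyl d N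
  | (some i, s) => (Pi.single i (if s then 1 else -1), 0)
  | (none, s) => (0, if s then 1 else -1)

/-- The law of one step: each signed unit vector has weight `1 / (2 (d + 1))`. -/
def stepLaw (d N : ℕ) : Measure (Cyl d N) :=
  ((PMF.uniformOfFintype (Option (Fin d) × Bool)).map (unitStep d N)).toMeasure

instance stepLaw_isProbabilityMeasure (d N : ℕ) : IsProbabilityMeasure (stepLaw d N) := by
  unfold stepLaw
  infer_instance

/-- The canonical law on `E^ℕ` of simple random walk on the cylinder with initial law `μ₀`:
the law of `n ↦ X₀ + ξ₁ + ⋯ + ξₙ`, where `X₀` has law `μ₀` and the `ξᵢ` are i.i.d. steps,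
independent of `X₀`. -/
def walkLaw (d N : ℕ) (μ₀ : Measure (Cyl d N)) : Measure (ℕ → Cyl d N) :=
  (μ₀.prod (Measure.infinitePi fun _ : ℕ => stepLaw d N)).map
    fun p n => p.1 + ∑ i ∈ Finset.range n, p.2 i

/-- `ν_a`: the uniform distribution on the level `𝕋 × {a}`. -/
def levelUniform (d N : ℕ) (a : ℤ) : Measure (Cyl d N) :=
  uniformOn {x : Cyl d N | x.2 = a}

/-! ### Grids -/

/-- The special grid points `z*_ℓ`: for each class of indices with a common limiting value
`v i`, the largest of the heights `z j` in the class. -/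
def specialGrid {M : ℕ} (v : Fin M → ℝ) (z : Fin M → ℤ) : Set ℤ :=
  {a | ∃ i, IsGreatest (z '' {j | v j = v i}) a}

/-- The grid `𝓖`: the special points, together with the points of `2 h ℤ` at distance at least
`2 h` from all special points. -/
def grid {M : ℕ} (v : Fin M → ℝ) (z : Fin M → ℤ) (h : ℕ) : Set ℤ :=
  specialGrid v z ∪
    {a | (2 * (h : ℤ)) ∣ a ∧ ∀ s ∈ specialGrid v z, 2 * (h : ℤ) ≤ |a - s|}

/-- `𝓖 + [-r, r]`. -/
def closedThickening (G : Set ℤ) (r : ℕ) : Set ℤ := {a | ∃ g ∈ G, |a - g| ≤ (r : ℤ)}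

/-- `𝓖 + (-r, r)`. -/
def openThickening (G : Set ℤ) (r : ℕ) : Set ℤ := {a | ∃ g ∈ G, |a - g| < (r : ℤ)}

/-! ### Return and departure times -/

/-- The first time at or after `t` at which the path `w` is in `A`; it is `⊤` if there is none. -/
def firstTimeFrom (w : ℕ → ℤ) (A : Set ℤ) (t : ℕ∞) : ℕ∞ :=
  ⨅ (n : ℕ) (_ : t ≤ (n : ℕ∞) ∧ w n ∈ A), (n : ℕ∞)

/-- The departure times `D_k`, `k ≥ 1`, with the convention `D_0 = 0`: `D_{k+1}` is the first exit
from `O` after the first entrance in `C` after `D_k`. -/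
def dep (C O : Set ℤ) (w : ℕ → ℤ) : ℕ → ℕ∞
  | 0 => 0
  | k + 1 => firstTimeFrom w Oᶜ (firstTimeFrom w C (dep C O w k))

/-- The return times `R_k`, `k ≥ 1`: `R_{k+1}` is the first entrance in `C` after `D_k`, with
`D_0 = 0`. The value at `k = 0` is a convention. -/
def ret (C O : Set ℤ) (w : ℕ → ℤ) : ℕ → ℕ∞
  | 0 => 0
  | k + 1 => firstTimeFrom w C (dep C O w k)

/-- The value of a path at a time `t`, meaningful for finite `t`. -/
def atTime {S : Type*} (w : ℕ → S) (t : ℕ∞) : S := w t.toNat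

/-- The path `w_{(r + ·) ∧ t}`. -/
def excursion {S : Type*} (w : ℕ → S) (r t : ℕ∞) : ℕ → S :=
  fun n => atTime w (min (r + (n : ℕ∞)) t)

/-- The vertical component of a path on the cylinder. -/
def vert {d N : ℕ} (x : ℕ → Cyl d N) : ℕ → ℤ := fun n => (x n).2

/-- The law `P_{a,b} = P_{ν_a}[ · | Z_{D_1} = b]` on `E^ℕ`. -/
def pinnedLaw (d N : ℕ) (C O : Set ℤ) (a b : ℤ) : Measure (ℕ → Cyl d N) :=
  (walkLaw d N (levelUniform d N a))[|{x | atTime (vert x) (dep C O (vert x) 1) = b}]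

/-- The law of `X_{· ∧ D_1}` under `P_{a,b}`. -/
def pinnedExcursionLaw (d N : ℕ) (C O : Set ℤ) (a b : ℤ) : Measure (ℕ → Cyl d N) :=
  (pinnedLaw d N C O a b).map fun x => excursion x 0 (dep C O (vert x) 1)

/-- The vertical data `(Z_{· ∧ D_1}, (Z_{R_k}, Z_{D_k})_{k ≥ 2})` of a vertical path; the pair
with index `j` of the sequence belongs to `k = j + 2`. -/
def verticalData (C O : Set ℤ) (w : ℕ → ℤ) : (ℕ → ℤ) × (ℕ → ℤ × ℤ) :=
  (excursion w 0 (dep C O w 1),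
    fun j => (atTime w (ret C O w (j + 2)), atTime w (dep C O w (j + 2))))

/-- The process `(Ỹ, Z_{(R_k + ·) ∧ D_k})`. -/
def auxExcursion {d N : ℕ} (C O : Set ℤ) (k : ℕ) (y : ℕ → Torus d N) (w : ℕ → ℤ) :
    ℕ → Cyl d N :=
  fun n => (y n, excursion w (ret C O w k) (dep C O w k) n)

end

end CylinderWalk

open CylinderWalk

namespace CylinderWalk

open scoped ENNReal

/-! Between a departure and the next return the walk starts outside `O` and must cover a vertical
distance of at least `h - δ`, which is at least `N (log N)² / 2` for large `N`. This leaves time for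
the torus component to mix, so the entrance point in `C`, restricted to a given height, is almost
uniform along the torus. Each excursion is therefore translated along the torus so that it begins at
an exactly uniform point; the vertical path is untouched, and the translation is trivial except with
small probability.

The probability space carries the starting point, the i.i.d. steps and, for each excursion, an
independent family of torus points indexed by all pairs (departure point, entrance point). The point
used is the one indexed by the pair that occurs. Because this family is i.i.d. and independent of
the steps, concatenation preserves the joint law and `strong_markov` applies to walk and noise
together.

Mixing (`sum_sum_abs_entrance_sub_le`) comes from Fourier analysis on the torus. For a nontrivial
character, `entranceChar` solves a second order recurrence in the starting height with coefficient
`2 (1 + charGap χ)`, where `charGap χ ≥ 2 / N²`. Comparison with a hyperbolic cosine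
(`le_inv_cosh_of_subharmonic`) bounds it by `1 / cosh (L / N)` at distance `L` from `C`. At most `N
^ d` characters contribute, and `pow_mul_inv_cosh_le` turns the result into `N ^ (-3 d)`. A maximal
coupling with the uniform law (`exists_coupling_uniform`) makes the mismatch probability no larger
than this (`noiseLaw_mismatch_le`).

For conditional independence, `noiseLaw_excursionEvent` shows that a corrected excursion forgets its
departure point except through the law of the entrance height. Iterating at departure times gives a
product formula for prescribed return and departure heights and arbitrary path events
(`exists_noiseLaw_initial`). Its prefactor does not involve the path events, so comparing with the
case where they are all trivial identifies the conditional probability;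
`condExp_indicator_of_cylinders` converts this into a conditional expectation. -/

/-! ### Gluing of sequences and the strong Markov property -/

/-- The sequence which follows `p.1` before time `n` and is `p.2`, started at time `n`, afterwards. -/
def glue {X : Type*} (n : ℕ) (p : (ℕ → X) × (ℕ → X)) : ℕ → X :=
  fun i => if i < n then p.1 i else p.2 (i - n)

lemma glue_of_lt {X : Type*} {n i : ℕ} (h : i < n) (p : (ℕ → X) × (ℕ → X)) :
    glue n p i = p.1 i := if_pos h

lemma glue_add {X : Type*} (n i : ℕ) (p : (ℕ → X) × (ℕ → X)) :
    glue n p (n + i) = p.2 i := by simp [glue]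

lemma glue_zero {X : Type*} (p : (ℕ → X) × (ℕ → X)) : glue 0 p = p.2 := by
  ext i; simp [glue]

lemma measurable_glue {X : Type*} [MeasurableSpace X] (n : ℕ) :
    Measurable (glue n : (ℕ → X) × (ℕ → X) → ℕ → X) := by
  refine measurable_pi_lambda _ fun i => ?_
  by_cases h : i < n
  · simp only [glue, h, if_true]; fun_prop
  · simp only [glue, h, if_false]; fun_prop

/-- An infinite product measure is determined by finite boxes, and the preimage of a box splits into
a box in the coordinates before `n` and a shifted box in the others. This is the Markov property of
i.i.d. steps at a fixed time. -/
lemma measurePreserving_glue {X : Type*} [MeasurableSpace X] (μ : Measure X)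
    [IsProbabilityMeasure μ] (n : ℕ) :
    MeasurePreserving (glue n) ((Measure.infinitePi fun _ : ℕ => μ).prod
      (Measure.infinitePi fun _ : ℕ => μ)) (Measure.infinitePi fun _ : ℕ => μ) := by
  refine ⟨measurable_glue n, ?_⟩
  refine Measure.eq_infinitePi _ fun s t ht => ?_
  rw [Measure.map_apply (measurable_glue n)
    (MeasurableSet.pi s.countable_toSet fun i _ => ht i)]
  have hpre : glue n ⁻¹' (Set.pi s t) =
      (Set.pi (s.filter (· < n)) t) ×ˢ
        (Set.pi ((s.filter (fun i => ¬ i < n)).image (· - n)) fun i => t (n + i)) := by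
    ext p
    simp only [Set.mem_preimage, Set.mem_pi, Set.mem_prod, Finset.coe_filter, Set.mem_ofPred_eq,
      Finset.coe_image, Set.mem_image, Finset.mem_coe]
    constructor
    · intro h
      refine ⟨fun i hi => by simpa [glue, hi.2] using h i hi.1, ?_⟩
      rintro _ ⟨i, ⟨hi, hin⟩, rfl⟩
      have := h i hi
      simp only [glue, hin, if_false] at this
      rwa [Nat.add_sub_of_le (not_lt.1 hin)]
    · rintro ⟨h1, h2⟩ i hi
      by_cases hin : i < n
      · simpa [glue, hin] using h1 i ⟨hi, hin⟩
      · have := h2 (i - n) ⟨i, ⟨hi, hin⟩, rfl⟩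
        rw [Nat.add_sub_of_le (not_lt.1 hin)] at this
        simpa [glue, hin] using this
  rw [hpre, Measure.prod_prod, Measure.infinitePi_pi _ (fun i _ => ht i),
    Measure.infinitePi_pi _ (fun i _ => ht _), Finset.prod_image,
    ← Finset.prod_filter_mul_prod_filter_not s (· < n)]
  · congr 1
    refine Finset.prod_congr rfl fun i hi => ?_
    rw [Nat.add_sub_of_le (not_lt.1 (Finset.mem_filter.1 hi).2)]
  · intro i hi j hj hij
    simp only [Finset.coe_filter, Set.mem_ofPred_eq] at hi hj
    simp only at hij
    omega

lemma measurePreserving_prod_prod_comm {X Y Z W : Type*} [MeasurableSpace X] [MeasurableSpace Y]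
    [MeasurableSpace Z] [MeasurableSpace W] (α : Measure X) (β : Measure Y) (γ : Measure Z)
    (ε : Measure W) [SFinite α] [SFinite β] [SFinite γ] [SFinite ε] :
    MeasurePreserving (fun p : (X × Y) × (Z × W) => ((p.1.1, p.2.1), (p.1.2, p.2.2)))
      ((α.prod β).prod (γ.prod ε)) ((α.prod γ).prod (β.prod ε)) := by
  have h1 := measurePreserving_prodAssoc α β (γ.prod ε)
  have h2 := (measurePreserving_prodAssoc β γ ε).symm
  have h3 := (Measure.measurePreserving_swap (μ := β) (ν := γ)).prod (MeasurePreserving.id ε)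
  have h4 := measurePreserving_prodAssoc γ β ε
  have h5 := (measurePreserving_prodAssoc α γ (β.prod ε)).symm
  exact h5.comp (((MeasurePreserving.id α).prod (h4.comp (h3.comp h2))).comp h1)

/-- The two cuts are independent of each other: the steps are cut at the value of a random time,
while the auxiliary sequence is cut after 0 terms (at a return) or 1 term (at a departure). -/
lemma measurePreserving_glue_prod {X Y : Type*} [MeasurableSpace X] [MeasurableSpace Y]
    (μ : Measure X) [IsProbabilityMeasure μ] (ν : Measure Y) [IsProbabilityMeasure ν] (n m : ℕ) :
    MeasurePreserving
      (fun p : ((ℕ → X) × (ℕ → Y)) × ((ℕ → X) × (ℕ → Y)) =>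
        (glue n (p.1.1, p.2.1), glue m (p.1.2, p.2.2)))
      (((Measure.infinitePi fun _ : ℕ => μ).prod (Measure.infinitePi fun _ : ℕ => ν)).prod
        ((Measure.infinitePi fun _ : ℕ => μ).prod (Measure.infinitePi fun _ : ℕ => ν)))
      ((Measure.infinitePi fun _ : ℕ => μ).prod (Measure.infinitePi fun _ : ℕ => ν)) := by
  have hg := (measurePreserving_glue μ n).prod (measurePreserving_glue ν m)
  exact hg.comp (measurePreserving_prod_prod_comm _ _ _ _)

/-- The strong Markov property, for a probability space with measure preserving concatenations. -/
lemma strong_markov {Ω : Type*} [MeasurableSpace Ω] (Q : Measure Ω) [IsProbabilityMeasure Q]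
    (g : ℕ → Ω × Ω → Ω) (hg : ∀ n, MeasurePreserving (g n) (Q.prod Q) Q)
    (τ : Ω → ℕ∞) (hτ : Measurable τ) (hfin : ∀ᵐ u ∂Q, τ u ≠ ⊤)
    (hloc : ∀ (n : ℕ) u v, τ (g n (u, v)) = n ↔ τ u = n)
    {H : Set Ω} (hH : MeasurableSet H) (F : Ω → Set Ω)
    (hF : ∀ n : ℕ, ∀ᵐ v ∂Q, ∀ u, τ u = n → (g n (u, v) ∈ H ↔ v ∈ F u)) :
    Q H = ∫⁻ u, Q (F u) ∂Q := by
  have hmeas : ∀ n : ℕ, MeasurableSet {u | τ u = n} := fun n => hτ (measurableSet_singleton _)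
  have hdisj : Pairwise (Function.onFun Disjoint fun n : ℕ => {u | τ u = n}) := by
    intro i j hij
    refine Set.disjoint_left.2 fun u hi hj => hij ?_
    have : (i : ℕ∞) = j := hi.symm.trans hj
    exact_mod_cast this
  have hcover : (⋃ n : ℕ, {u | τ u = n}) =ᵐ[Q] Set.univ := by
    filter_upwards [hfin] with u hu
    obtain ⟨n, hn⟩ := ENat.ne_top_iff_exists.1 hu
    exact propext ⟨fun _ => trivial, fun _ => Set.mem_iUnion.2 ⟨n, hn.symm⟩⟩
  have h1 : Q H = ∑' n : ℕ, Q (H ∩ {u | τ u = n}) := by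
    rw [← measure_iUnion (fun i j hij => (hdisj hij).mono Set.inter_subset_right
      Set.inter_subset_right) (fun n => hH.inter (hmeas n)), ← Set.inter_iUnion]
    refine measure_congr ?_
    simpa using (ae_eq_refl H).inter hcover.symm
  have h2 : ∫⁻ u, Q (F u) ∂Q = ∑' n : ℕ, ∫⁻ u in {u | τ u = n}, Q (F u) ∂Q := by
    rw [← lintegral_iUnion hmeas hdisj, setLIntegral_congr hcover, Measure.restrict_univ]
  rw [h1, h2]
  refine tsum_congr fun n => ?_
  -- On `{τ = n}` the sample is replaced by a concatenation at `n`. By `hloc` the first factor alone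
  -- decides whether `τ = n`, so the section over `u` is `F u` or empty.
  rw [← (hg n).measure_preimage (hH.inter (hmeas n)).nullMeasurableSet,
    Measure.prod_apply ((hg n).measurable (hH.inter (hmeas n))), ← lintegral_indicator (hmeas n)]
  refine lintegral_congr fun u => ?_
  by_cases hu : τ u = n
  · rw [Set.indicator_of_mem (show u ∈ {u | τ u = n} from hu)]
    refine measure_congr ?_
    filter_upwards [hF n] with v hv
    refine propext ?_
    have := hv u hu
    change (g n (u, v) ∈ H ∧ τ (g n (u, v)) = n) ↔ v ∈ F u
    rw [hloc, this]
    exact and_iff_left hu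
  · rw [Set.indicator_of_notMem (show u ∉ {u | τ u = n} from hu)]
    convert measure_empty (μ := Q)
    ext v
    simp only [Set.mem_preimage, Set.mem_inter_iff, Set.mem_ofPred_eq, Set.mem_empty_iff_false,
      iff_false, not_and]
    rw [hloc]
    exact fun _ => hu

instance countable_zmod (N : ℕ) : Countable (ZMod N) := by
  cases N
  · exact inferInstanceAs (Countable ℤ)
  · exact inferInstanceAs (Countable (Fin _))

instance discreteMeasurableSpace_torus (d N : ℕ) : DiscreteMeasurableSpace (Torus d N) :=
  MeasurableSingletonClass.toDiscreteMeasurableSpace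

/-! ### Hitting times of deterministic paths -/

lemma firstTimeFrom_eq_top_iff {w : ℕ → ℤ} {A : Set ℤ} {t : ℕ∞} :
    firstTimeFrom w A t = ⊤ ↔ ∀ n : ℕ, t ≤ n → w n ∉ A := by
  simp [firstTimeFrom]

lemma firstTimeFrom_eq_coe_iff {w : ℕ → ℤ} {A : Set ℤ} {t : ℕ∞} {n : ℕ} :
    firstTimeFrom w A t = n ↔ t ≤ n ∧ w n ∈ A ∧ ∀ m < n, t ≤ m → w m ∉ A := by
  constructor
  · intro h
    have hlow : ∀ m < n, t ≤ m → w m ∉ A := by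
      intro m hm htm hA
      have : firstTimeFrom w A t ≤ m := iInf₂_le m ⟨htm, hA⟩
      rw [h] at this
      exact absurd (by exact_mod_cast this) (not_le.2 hm)
    by_contra hcon
    have : ((n + 1 : ℕ) : ℕ∞) ≤ firstTimeFrom w A t := by
      refine le_iInf₂ fun m hm => ?_
      have h1 : ¬ m < n := fun hlt => hlow m hlt hm.1 hm.2
      have h2 : m ≠ n := by
        rintro rfl
        exact hcon ⟨hm.1, hm.2, hlow⟩
      exact_mod_cast (show n + 1 ≤ m by omega)
    rw [h] at this
    have : n + 1 ≤ n := by exact_mod_cast this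
    omega
  · rintro ⟨h1, h2, h3⟩
    refine le_antisymm (iInf₂_le n ⟨h1, h2⟩) (le_iInf₂ fun m hm => ?_)
    by_contra hlt
    exact h3 m (by exact_mod_cast not_le.1 hlt) hm.1 hm.2

lemma le_firstTimeFrom (w : ℕ → ℤ) (A : Set ℤ) (t : ℕ∞) : t ≤ firstTimeFrom w A t :=
  le_iInf₂ fun _ h => h.1

lemma atTime_firstTimeFrom_mem {w : ℕ → ℤ} {A : Set ℤ} {t : ℕ∞}
    (h : firstTimeFrom w A t ≠ ⊤) : atTime w (firstTimeFrom w A t) ∈ A := by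
  obtain ⟨n, hn⟩ := ENat.ne_top_iff_exists.1 h
  rw [← hn]
  exact (firstTimeFrom_eq_coe_iff.1 hn.symm).2.1

lemma firstTimeFrom_shift (w : ℕ → ℤ) (A : Set ℤ) (n : ℕ) (t : ℕ∞) :
    firstTimeFrom w A (n + t) = n + firstTimeFrom (fun m => w (n + m)) A t := by
  have key : ∀ m : ℕ, (n : ℕ∞) + t ≤ ((n + m : ℕ) : ℕ∞) ↔ t ≤ m := by
    intro m
    push_cast
    exact ENat.add_le_add_iff_left (ENat.natCast_ne_top n)
  have hge : ∀ k : ℕ, (n : ℕ∞) + t ≤ k → ∃ m, k = n + m := by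
    intro k hk
    have : (n : ℕ∞) ≤ k := le_self_add.trans hk
    exact Nat.exists_eq_add_of_le (by exact_mod_cast this)
  by_cases h : firstTimeFrom (fun m => w (n + m)) A t = ⊤
  · rw [h, add_top, firstTimeFrom_eq_top_iff]
    rw [firstTimeFrom_eq_top_iff] at h
    intro k hk
    obtain ⟨m, rfl⟩ := hge k hk
    exact h m ((key m).1 hk)
  · obtain ⟨m, hm⟩ := ENat.ne_top_iff_exists.1 h
    obtain ⟨h1, h2, h3⟩ := firstTimeFrom_eq_coe_iff.1 hm.symm
    rw [← hm, ← Nat.cast_add, firstTimeFrom_eq_coe_iff]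
    refine ⟨(key m).2 h1, h2, fun k hk htk => ?_⟩
    obtain ⟨i, rfl⟩ := hge k htk
    exact h3 i (by omega) ((key i).1 htk)

/-- A first time that is at most `n` inspects the path only up to `n`. This locality is what makes
returns and departures stopping times. -/
lemma firstTimeFrom_congr {w w' : ℕ → ℤ} {n : ℕ} (h : ∀ i ≤ n, w i = w' i) (A : Set ℤ) (t : ℕ∞)
    (hn : firstTimeFrom w A t ≤ n) : firstTimeFrom w' A t = firstTimeFrom w A t := by
  obtain ⟨m, hm⟩ := ENat.ne_top_iff_exists.1 (ne_top_of_le_ne_top (ENat.natCast_ne_top n) hn)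
  rw [← hm] at hn ⊢
  have hmn : m ≤ n := by exact_mod_cast hn
  obtain ⟨h1, h2, h3⟩ := firstTimeFrom_eq_coe_iff.1 hm.symm
  refine firstTimeFrom_eq_coe_iff.2 ⟨h1, h m hmn ▸ h2, fun i hi hti => ?_⟩
  rw [← h i (by omega)]
  exact h3 i hi hti

lemma ret_one_le_dep_one (C O : Set ℤ) (w : ℕ → ℤ) : ret C O w 1 ≤ dep C O w 1 :=
  le_firstTimeFrom _ _ _

lemma ret_one_congr {C O : Set ℤ} {w w' : ℕ → ℤ} {n : ℕ} (h : ∀ i ≤ n, w i = w' i)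
    (hn : ret C O w 1 ≤ n) : ret C O w' 1 = ret C O w 1 :=
  firstTimeFrom_congr h _ _ hn

lemma dep_one_congr {C O : Set ℤ} {w w' : ℕ → ℤ} {n : ℕ} (h : ∀ i ≤ n, w i = w' i)
    (hn : dep C O w 1 ≤ n) : dep C O w' 1 = dep C O w 1 := by
  have h1 := ret_one_congr (C := C) (O := O) h ((ret_one_le_dep_one C O w).trans hn)
  change firstTimeFrom w' Oᶜ (ret C O w' 1) = _
  rw [h1]
  exact firstTimeFrom_congr h _ _ hn

lemma ret_one_eq_iff {C O : Set ℤ} {w w' : ℕ → ℤ} {n : ℕ} (h : ∀ i ≤ n, w i = w' i) :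
    ret C O w 1 = n ↔ ret C O w' 1 = n :=
  ⟨fun hn => (ret_one_congr h hn.le).trans hn,
    fun hn => (ret_one_congr (fun i hi => (h i hi).symm) hn.le).trans hn⟩

lemma dep_one_eq_iff {C O : Set ℤ} {w w' : ℕ → ℤ} {n : ℕ} (h : ∀ i ≤ n, w i = w' i) :
    dep C O w 1 = n ↔ dep C O w' 1 = n :=
  ⟨fun hn => (dep_one_congr h hn.le).trans hn,
    fun hn => (dep_one_congr (fun i hi => (h i hi).symm) hn.le).trans hn⟩

/-- Renewal structure: seen from the first departure, the shifted path has the same departure times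
with index lowered by one. -/
lemma dep_succ_of_dep_one {C O : Set ℤ} {w : ℕ → ℤ} {n : ℕ} (h : dep C O w 1 = n) (k : ℕ) :
    dep C O w (k + 1) = n + dep C O (fun m => w (n + m)) k := by
  induction k with
  | zero => rw [h]; simp [dep]
  | succ k ih =>
    rw [dep, ih, firstTimeFrom_shift, firstTimeFrom_shift]
    rfl

lemma ret_succ_of_dep_one {C O : Set ℤ} {w : ℕ → ℤ} {n : ℕ} (h : dep C O w 1 = n) (k : ℕ) :
    ret C O w (k + 2) = n + ret C O (fun m => w (n + m)) (k + 1) := by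
  rw [ret, dep_succ_of_dep_one h, firstTimeFrom_shift]
  rfl

lemma ret_one_of_mem {C : Set ℤ} (O : Set ℤ) {w : ℕ → ℤ} (h : w 0 ∈ C) : ret C O w 1 = 0 := by
  have : firstTimeFrom w C 0 = ((0 : ℕ) : ℕ∞) := firstTimeFrom_eq_coe_iff.2 (by simp [h])
  exact this

/-- The path shifted to its first return starts in `C`, so its own first return time is 0 and its
first departure ends the same excursion. -/
lemma dep_one_of_ret_one {C O : Set ℤ} {w : ℕ → ℤ} {n : ℕ} (h : ret C O w 1 = n) :
    dep C O w 1 = n + dep C O (fun m => w (n + m)) 1 := by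
  have hC : w n ∈ C := (firstTimeFrom_eq_coe_iff.1 h).2.1
  have h0 : ret C O (fun m => w (n + m)) 1 = 0 := ret_one_of_mem O hC
  change firstTimeFrom w Oᶜ (ret C O w 1) =
    n + firstTimeFrom (fun m => w (n + m)) Oᶜ (ret C O (fun m => w (n + m)) 1)
  rw [h, h0, ← firstTimeFrom_shift, add_zero]

/-- Finiteness is essential: `⊤.toNat = 0`, so at `⊤` the left side would read `w 0` and the right
side `w n`. -/
lemma atTime_coe_add {S : Type*} (w : ℕ → S) (n : ℕ) {t : ℕ∞} (ht : t ≠ ⊤) :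
    atTime w (n + t) = atTime (fun m => w (n + m)) t := by
  lift t to ℕ using ht
  rw [← Nat.cast_add]
  rfl

lemma excursion_coe_add {S : Type*} (w : ℕ → S) (n : ℕ) {r : ℕ∞} (hr : r ≠ ⊤) (t : ℕ∞) :
    excursion w (n + r) (n + t) = excursion (fun m => w (n + m)) r t := by
  ext m
  rw [excursion, excursion, add_assoc, min_add_add_left, atTime_coe_add]
  exact ne_top_of_le_ne_top (by simpa using hr) (min_le_left _ _)

lemma atTime_congr {S : Type*} {w w' : ℕ → S} {n : ℕ} (h : ∀ i ≤ n, w i = w' i) {t : ℕ∞}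
    (ht : t ≤ n) : atTime w t = atTime w' t :=
  h _ (ENat.toNat_le_of_le_natCast ht)

lemma excursion_congr {S : Type*} {w w' : ℕ → S} {n : ℕ} (h : ∀ i ≤ n, w i = w' i) (r : ℕ∞)
    {t : ℕ∞} (ht : t ≤ n) : excursion w r t = excursion w' r t :=
  funext fun _ => atTime_congr h ((min_le_right _ _).trans ht)

/-! ### Measurability -/

lemma measurable_firstTimeFrom {Ω : Type*} [MeasurableSpace Ω] {f : Ω → ℕ → ℤ}
    (hf : Measurable f) (A : Set ℤ) {t : Ω → ℕ∞} (ht : Measurable t) :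
    Measurable fun ω => firstTimeFrom (f ω) A (t ω) := by
  have hs : ∀ n : ℕ, MeasurableSet {ω | t ω ≤ n ∧ f ω n ∈ A} := fun n =>
    (ht (MeasurableSet.of_discrete (s := Set.Iic (n : ℕ∞)))).inter
      ((measurable_pi_apply n).comp hf (MeasurableSet.of_discrete (s := A)))
  refine measurable_to_countable' fun k => ?_
  induction k using ENat.recTopCoe with
  | top =>
    have : (fun ω => firstTimeFrom (f ω) A (t ω)) ⁻¹' {⊤} =
        ⋂ n : ℕ, {ω | t ω ≤ n ∧ f ω n ∈ A}ᶜ := by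
      ext ω
      simp [firstTimeFrom_eq_top_iff]
    rw [this]
    exact MeasurableSet.iInter fun n => (hs n).compl
  | coe k =>
    have : (fun ω => firstTimeFrom (f ω) A (t ω)) ⁻¹' {(k : ℕ∞)} =
        {ω | t ω ≤ k ∧ f ω k ∈ A} ∩ ⋂ m ∈ Finset.range k, {ω | t ω ≤ m ∧ f ω m ∈ A}ᶜ := by
      ext ω
      simp [firstTimeFrom_eq_coe_iff, and_assoc]
    rw [this]
    exact (hs k).inter (Finset.measurableSet_biInter _ fun m _ => (hs m).compl)

@[fun_prop]
lemma measurable_dep (C O : Set ℤ) (k : ℕ) : Measurable fun w => dep C O w k := by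
  induction k with
  | zero => exact measurable_const
  | succ k ih =>
    exact measurable_firstTimeFrom measurable_id _ (measurable_firstTimeFrom measurable_id _ ih)

@[fun_prop]
lemma measurable_ret (C O : Set ℤ) (k : ℕ) : Measurable fun w => ret C O w k := by
  cases k with
  | zero => exact measurable_const
  | succ k => exact measurable_firstTimeFrom measurable_id _ (measurable_dep C O k)

lemma measurable_atTime {Ω S : Type*} [MeasurableSpace Ω] [MeasurableSpace S] {f : Ω → ℕ → S}
    (hf : Measurable f) {t : Ω → ℕ∞} (ht : Measurable t) :
    Measurable fun ω => atTime (f ω) (t ω) := by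
  have h1 : Measurable fun p : (ℕ → S) × ℕ => p.1 p.2 :=
    measurable_from_prod_countable_left fun n => measurable_pi_apply n
  have h2 : Measurable fun ω => (t ω).toNat := Measurable.of_discrete.comp ht
  exact h1.comp (hf.prodMk h2)

lemma measurable_excursion {Ω S : Type*} [MeasurableSpace Ω] [MeasurableSpace S] {f : Ω → ℕ → S}
    (hf : Measurable f) {r t : Ω → ℕ∞} (hr : Measurable r) (ht : Measurable t) :
    Measurable fun ω => excursion (f ω) (r ω) (t ω) := by
  refine measurable_pi_lambda _ fun n => measurable_atTime hf ?_
  exact (Measurable.of_discrete (f := fun p : ℕ∞ × ℕ∞ => min (p.1 + n) p.2)).comp (hr.prodMk ht)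

@[fun_prop]
lemma measurable_vert {d N : ℕ} : Measurable (vert : (ℕ → Cyl d N) → ℕ → ℤ) :=
  measurable_pi_lambda _ fun n => measurable_snd.comp (measurable_pi_apply n)

/-! ### Paths -/

/-- The path started at `x` with increments `ξ`. -/
def path {d N : ℕ} (x : Cyl d N) (ξ : ℕ → Cyl d N) : ℕ → Cyl d N :=
  fun n => x + ∑ i ∈ Finset.range n, ξ i

@[simp]
lemma path_zero {d N : ℕ} (x : Cyl d N) (ξ : ℕ → Cyl d N) : path x ξ 0 = x := by simp [path]

lemma path_succ {d N : ℕ} (x : Cyl d N) (ξ : ℕ → Cyl d N) (n : ℕ) :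
    path x ξ (n + 1) = path x ξ n + ξ n := by
  simp [path, Finset.sum_range_succ, add_assoc]

lemma measurable_path_prod {d N : ℕ} :
    Measurable fun p : Cyl d N × (ℕ → Cyl d N) => path p.1 p.2 := by
  refine measurable_pi_lambda _ fun n => ?_
  have hadd : Measurable fun p : Cyl d N × Cyl d N => p.1 + p.2 := Measurable.of_discrete
  induction n with
  | zero => simpa using measurable_fst
  | succ n ih =>
    simp only [path_succ]
    exact hadd.comp (ih.prodMk ((measurable_pi_apply n).comp measurable_snd))

@[fun_prop]
lemma measurable_path {d N : ℕ} (x : Cyl d N) : Measurable (path x) :=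
  measurable_path_prod.comp measurable_prodMk_left

lemma path_glue_of_le {d N : ℕ} (x : Cyl d N) {n i : ℕ} (h : i ≤ n)
    (p : (ℕ → Cyl d N) × (ℕ → Cyl d N)) : path x (glue n p) i = path x p.1 i := by
  unfold path
  congr 1
  refine Finset.sum_congr rfl fun j hj => glue_of_lt ?_ p
  have := Finset.mem_range.1 hj
  omega

lemma path_glue_add {d N : ℕ} (x : Cyl d N) (n m : ℕ)
    (p : (ℕ → Cyl d N) × (ℕ → Cyl d N)) :
    path x (glue n p) (n + m) = path (path x p.1 n) p.2 m := by
  induction m with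
  | zero => simpa using path_glue_of_le x le_rfl p
  | succ m ih => rw [← add_assoc, path_succ, ih, path_succ, glue_add]

lemma vert_path_glue_of_le {d N : ℕ} (x : Cyl d N) {n i : ℕ} (h : i ≤ n)
    (p : (ℕ → Cyl d N) × (ℕ → Cyl d N)) :
    vert (path x (glue n p)) i = vert (path x p.1) i :=
  congrArg Prod.snd (path_glue_of_le x h p)

lemma vert_path_glue_add {d N : ℕ} (x : Cyl d N) (n : ℕ)
    (p : (ℕ → Cyl d N) × (ℕ → Cyl d N)) :
    (fun m => vert (path x (glue n p)) (n + m)) = vert (path (path x p.1 n) p.2) :=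
  funext fun m => congrArg Prod.snd (path_glue_add x n m p)

/-- Translation along the torus commutes with the walk and leaves heights, hence all return and
departure times, unchanged. -/
lemma path_add_left {d N : ℕ} (y : Torus d N) (x : Cyl d N) (ξ : ℕ → Cyl d N) (n : ℕ) :
    path ((y, 0) + x) ξ n = (y, 0) + path x ξ n := by
  simp [path, add_assoc]

lemma vert_path_congr {d N : ℕ} {x x' : Cyl d N} (h : x.2 = x'.2) (ξ : ℕ → Cyl d N) :
    vert (path x ξ) = vert (path x' ξ) := by
  ext n
  simp [vert, path, h]

lemma vert_atTime {d N : ℕ} (w : ℕ → Cyl d N) (t : ℕ∞) : (atTime w t).2 = atTime (vert w) t := rfl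

/-! ### Finiteness of the return and departure times -/

/-- The law of the sequence of steps. -/
noncomputable abbrev stepsLaw (d N : ℕ) : Measure (ℕ → Cyl d N) :=
  Measure.infinitePi fun _ : ℕ => stepLaw d N

/-- A set of integers which is unbounded in both directions. -/
def TwoSided (A : Set ℤ) : Prop := ∀ z : ℤ, (∃ a ∈ A, a < z) ∧ ∃ a ∈ A, z < a

/-- Sequences of unit steps with arbitrarily long and late runs of upward steps. -/
def recurrentSteps (d N : ℕ) : Set (ℕ → Cyl d N) :=
  {ξ | (∀ n, ξ n ∈ Set.range (unitStep d N)) ∧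
    ∀ n c : ℕ, ∃ m, n ≤ m ∧ ∀ i < c, ξ (m + i) = (0, 1)}

lemma abs_unitStep_snd_le {d N : ℕ} (s : Option (Fin d) × Bool) : |(unitStep d N s).2| ≤ 1 := by
  rcases s with ⟨_ | i, _ | _⟩ <;> simp [unitStep]

/-- Unit steps cannot jump over a height. A path avoiding `A` would stay strictly between two points
`l < r` of `A`, but a run of `r - l` upward steps leaves that interval. The argument is
deterministic, so a single null set serves all starting points and all times. -/
lemma firstTimeFrom_ne_top {d N : ℕ} {ξ : ℕ → Cyl d N} (hξ : ξ ∈ recurrentSteps d N)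
    {A : Set ℤ} (hA : TwoSided A) (x : Cyl d N) {t : ℕ∞} (ht : t ≠ ⊤) :
    firstTimeFrom (vert (path x ξ)) A t ≠ ⊤ := by
  lift t to ℕ using ht
  intro htop
  rw [firstTimeFrom_eq_top_iff] at htop
  set w := vert (path x ξ) with hw
  have hstep : ∀ n, w (n + 1) = w n + (ξ n).2 := fun n => by
    simp [hw, vert, path_succ]
  obtain ⟨⟨l, hlA, hl⟩, r, hrA, hr⟩ := hA (w t)
  have hin : ∀ k, l < w (t + k) ∧ w (t + k) < r := by
    intro k
    induction k with
    | zero => exact ⟨hl, hr⟩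
    | succ k ih =>
      obtain ⟨s, hs⟩ := hξ.1 (t + k)
      have h1 := abs_le.1 (abs_unitStep_snd_le (N := N) s)
      rw [hs] at h1
      have h2 := hstep (t + k)
      have h3 := htop (t + (k + 1)) (by exact_mod_cast Nat.le_add_right _ _)
      have h4 : w (t + (k + 1)) ≠ l := fun h => h3 (h ▸ hlA)
      have h5 : w (t + (k + 1)) ≠ r := fun h => h3 (h ▸ hrA)
      rw [← add_assoc] at h4 h5 ⊢
      omega
  obtain ⟨m, hm, hrun⟩ := hξ.2 t (r - l).toNat
  have hup : ∀ i ≤ (r - l).toNat, w (m + i) = w m + i := by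
    intro i hi
    induction i with
    | zero => simp
    | succ i ih =>
      rw [← add_assoc, hstep, ih (by omega), hrun i (by omega)]
      push_cast
      ring
  obtain ⟨k, rfl⟩ := Nat.exists_eq_add_of_le hm
  have h1 := hup _ le_rfl
  have h2 := (hin (k + (r - l).toNat)).2
  have h3 := (hin k).1
  rw [← add_assoc, h1] at h2
  have h4 : ((r - l).toNat : ℤ) = r - l := Int.toNat_of_nonneg (by omega)
  omega

lemma dep_ne_top {d N : ℕ} {ξ : ℕ → Cyl d N} (hξ : ξ ∈ recurrentSteps d N)
    {C O : Set ℤ} (hC : TwoSided C) (hO : TwoSided Oᶜ) (x : Cyl d N) (k : ℕ) :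
    dep C O (vert (path x ξ)) k ≠ ⊤ := by
  induction k with
  | zero => exact ENat.zero_ne_top
  | succ k ih => exact firstTimeFrom_ne_top hξ hO x (firstTimeFrom_ne_top hξ hC x ih)

lemma ret_ne_top {d N : ℕ} {ξ : ℕ → Cyl d N} (hξ : ξ ∈ recurrentSteps d N)
    {C O : Set ℤ} (hC : TwoSided C) (hO : TwoSided Oᶜ) (x : Cyl d N) (k : ℕ) :
    ret C O (vert (path x ξ)) k ≠ ⊤ := by
  cases k with
  | zero => exact ENat.zero_ne_top
  | succ k => exact firstTimeFrom_ne_top hξ hC x (dep_ne_top hξ hC hO x k)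

lemma stepLaw_apply_unitStep_pos (d N : ℕ) (s : Option (Fin d) × Bool) :
    0 < stepLaw d N {unitStep d N s} := by
  rw [stepLaw, PMF.toMeasure_apply_singleton _ _ (measurableSet_singleton _), PMF.map_apply,
    pos_iff_ne_zero]
  intro h
  have := ENNReal.tsum_eq_zero.1 h s
  rw [if_pos rfl, PMF.uniformOfFintype_apply, ENNReal.inv_eq_zero] at this
  exact ENNReal.natCast_ne_top _ this

lemma stepLaw_range (d N : ℕ) : ∀ᵐ s ∂stepLaw d N, s ∈ Set.range (unitStep d N) := by
  let : MeasurableSpace (Option (Fin d) × Bool) := ⊤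
  rw [stepLaw, ← PMF.toMeasure_map _ _ Measurable.of_discrete]
  exact (ae_map_iff Measurable.of_discrete.aemeasurable MeasurableSet.of_discrete).2
    (Eventually.of_forall fun s => ⟨s, rfl⟩)

/-- Consecutive blocks of length `c` after time `n` are independent, and each is a run with the same
positive probability. Failure of the first `k` blocks thus has probability the `k`-th power of a
number below one. -/
lemma ae_exists_run (d N n c : ℕ) :
    ∀ᵐ ξ ∂stepsLaw d N, ∃ m, n ≤ m ∧ ∀ i < c, ξ (m + i) = (0, 1) := by
  set up : Cyl d N := (0, 1) with hup
  set E : Set (ℕ → Cyl d N) := {ξ | ¬ ∀ i < c, ξ i = up} with hE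
  have hEc : Eᶜ = Set.pi (Finset.range c) fun _ => {up} := by
    ext ξ
    simp [hE, Set.mem_pi]
  have hmE : MeasurableSet E := by
    rw [← compl_compl E, hEc]
    exact (MeasurableSet.pi (Finset.range c).countable_toSet
      fun _ _ => measurableSet_singleton _).compl
  have hE1 : stepsLaw d N E < 1 := by
    have h1 : 0 < stepsLaw d N Eᶜ := by
      rw [hEc, Measure.infinitePi_pi _ fun _ _ => measurableSet_singleton _,
        Finset.prod_const]
      have := stepLaw_apply_unitStep_pos d N (none, true)
      exact pos_iff_ne_zero.2 (pow_ne_zero _ this.ne')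
    rw [← compl_compl E, prob_compl_eq_one_sub hmE.compl]
    exact ENNReal.sub_lt_self ENNReal.one_ne_top one_ne_zero h1.ne'
  -- the probability of having no run in `k` consecutive blocks after time `n`
  set F : ℕ → ℕ → Set (ℕ → Cyl d N) :=
    fun n k => {ξ | ∀ j < k, ¬ ∀ i < c, ξ (n + j * c + i) = up} with hF
  have hmF : ∀ n k, MeasurableSet (F n k) := by
    intro n k
    have : F n k = ⋂ j ∈ Finset.range k, (fun ξ i => ξ (n + j * c + i)) ⁻¹' E := by
      ext ξ
      simp [hF, hE]
    rw [this]
    refine Finset.measurableSet_biInter _ fun j _ => ?_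
    exact (measurable_pi_lambda _ fun i => measurable_pi_apply _) hmE
  have hF0 : ∀ k, stepsLaw d N (F 0 k) = stepsLaw d N E ^ k := by
    intro k
    induction k with
    | zero => simp [hF]
    | succ k ih =>
      rw [← (measurePreserving_glue (stepLaw d N) c).measure_preimage
        (hmF 0 (k + 1)).nullMeasurableSet]
      have : glue c ⁻¹' (F 0 (k + 1)) = E ×ˢ F 0 k := by
        ext p
        simp only [hF, hE, Set.mem_preimage, Set.mem_prod, Set.mem_ofPred_eq, zero_add]
        rw [Nat.forall_lt_succ_left]
        refine and_congr ?_ ?_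
        · refine not_congr (forall₂_congr fun i hi => ?_)
          rw [zero_mul, zero_add, glue_of_lt hi]
        · refine forall₂_congr fun j hj => not_congr (forall₂_congr fun i hi => ?_)
          rw [show (j + 1) * c + i = c + (j * c + i) by ring, glue_add]
      rw [this, Measure.prod_prod, ih, pow_succ']
  have hFn : ∀ k, stepsLaw d N (F n k) = stepsLaw d N E ^ k := by
    intro k
    rw [← hF0 k, ← (measurePreserving_glue (stepLaw d N) n).measure_preimage
        (hmF n k).nullMeasurableSet]
    have : glue n ⁻¹' (F n k) = Set.univ ×ˢ F 0 k := by
      ext p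
      simp only [hF, Set.mem_preimage, Set.mem_prod, Set.mem_ofPred_eq, zero_add, Set.mem_univ,
        true_and]
      refine forall₂_congr fun j hj => not_congr (forall₂_congr fun i hi => ?_)
      rw [add_assoc, glue_add]
    rw [this, Measure.prod_prod, measure_univ, one_mul]
  rw [ae_iff]
  refine le_antisymm (ge_of_tendsto' (ENNReal.tendsto_pow_atTop_nhds_zero_of_lt_one hE1)
    fun k => ?_) zero_le
  rw [← hFn k]
  refine measure_mono fun ξ hξ => ?_
  intro j _ hrun
  exact hξ ⟨n + j * c, by omega, hrun⟩

lemma ae_recurrentSteps (d N : ℕ) : ∀ᵐ ξ ∂stepsLaw d N, ξ ∈ recurrentSteps d N := by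
  have h1 : ∀ᵐ ξ ∂stepsLaw d N, ∀ n, ξ n ∈ Set.range (unitStep d N) := by
    refine ae_all_iff.2 fun n => ?_
    exact (measurePreserving_eval_infinitePi (fun _ : ℕ => stepLaw d N) n).quasiMeasurePreserving.ae
      (stepLaw_range d N)
  have h2 : ∀ᵐ ξ ∂stepsLaw d N, ∀ n c : ℕ, ∃ m, n ≤ m ∧ ∀ i < c, ξ (m + i) = (0, 1) :=
    ae_all_iff.2 fun n => ae_all_iff.2 fun c => ae_exists_run d N n c
  filter_upwards [h1, h2] with ξ h1 h2 using ⟨h1, h2⟩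

/-! ### Characters of the torus -/

/-- The powers of `ζ` sum to zero, so `N = ∑ (1 - ζ ^ j) ≤ ∑ j ‖1 - ζ‖ ≤ N² / 2 · ‖1 - ζ‖` in norm.
Combine `‖1 - ζ‖ ≥ 2 / N` with `‖1 - ζ‖² = 2 (1 - Re ζ)`, valid on the unit circle. -/
lemma two_div_sq_le_one_sub_re {N : ℕ} (hN : 0 < N) {ζ : ℂ} (h1 : ζ ^ N = 1) (h2 : ζ ≠ 1) :
    2 / (N : ℝ) ^ 2 ≤ 1 - ζ.re := by
  have hNR : (0 : ℝ) < N := by exact_mod_cast hN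
  have hnorm : ‖ζ‖ = 1 := Complex.norm_eq_one_of_pow_eq_one h1 hN.ne'
  have hgeom : ∑ j ∈ Finset.range N, ζ ^ j = 0 := by
    have := geom_sum_mul ζ N
    rw [h1, sub_self] at this
    exact (mul_eq_zero.1 this).resolve_right (sub_ne_zero.2 h2)
  have hpow : ∀ j : ℕ, ‖1 - ζ ^ j‖ ≤ j * ‖1 - ζ‖ := by
    intro j
    induction j with
    | zero => simp
    | succ j ih =>
      have : 1 - ζ ^ (j + 1) = (1 - ζ ^ j) + ζ ^ j * (1 - ζ) := by ring
      rw [this]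
      refine (norm_add_le _ _).trans ?_
      rw [norm_mul, norm_pow, hnorm, one_pow, one_mul]
      push_cast
      linarith
  have hsum : (N : ℝ) ≤ (∑ j ∈ Finset.range N, (j : ℝ)) * ‖1 - ζ‖ := by
    have : (N : ℂ) = ∑ j ∈ Finset.range N, (1 - ζ ^ j) := by
      rw [Finset.sum_sub_distrib, hgeom]; simp
    calc (N : ℝ) = ‖(N : ℂ)‖ := by simp
      _ ≤ ∑ j ∈ Finset.range N, ‖1 - ζ ^ j‖ := by rw [this]; exact norm_sum_le _ _
      _ ≤ ∑ j ∈ Finset.range N, (j : ℝ) * ‖1 - ζ‖ := Finset.sum_le_sum fun j _ => hpow j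
      _ = _ := by rw [Finset.sum_mul]
  have hgauss : (∑ j ∈ Finset.range N, (j : ℝ)) ≤ (N : ℝ) ^ 2 / 2 := by
    have h := Finset.sum_range_id_mul_two N
    have h' : (∑ j ∈ Finset.range N, (j : ℝ)) * 2 ≤ N * N := by
      have : (∑ i ∈ Finset.range N, i) * 2 ≤ N * N := h ▸ Nat.mul_le_mul_left _ (Nat.sub_le _ _)
      have h'' : (((∑ i ∈ Finset.range N, i) * 2 : ℕ) : ℝ) ≤ ((N * N : ℕ) : ℝ) := Nat.cast_le.2 this
      push_cast at h''
      exact h''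
    nlinarith
  have hlow : 2 / (N : ℝ) ≤ ‖1 - ζ‖ := by
    rw [div_le_iff₀ hNR]
    have : (N : ℝ) ≤ (N : ℝ) ^ 2 / 2 * ‖1 - ζ‖ :=
      hsum.trans (mul_le_mul_of_nonneg_right hgauss (norm_nonneg _))
    have h3 : (N : ℝ) * 1 ≤ N * (N * ‖1 - ζ‖ / 2) := by nlinarith
    have := le_of_mul_le_mul_left h3 hNR
    linarith
  have hsq : ‖1 - ζ‖ ^ 2 = 2 * (1 - ζ.re) := by
    have h3 : ζ.re ^ 2 + ζ.im ^ 2 = 1 := by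
      have := Complex.sq_norm ζ
      rw [hnorm, Complex.normSq_apply] at this
      nlinarith
    rw [Complex.sq_norm, Complex.normSq_apply]
    simp only [Complex.sub_re, Complex.one_re, Complex.sub_im, Complex.one_im]
    nlinarith
  have h4 : (2 / (N : ℝ)) ^ 2 ≤ ‖1 - ζ‖ ^ 2 := pow_le_pow_left₀ (by positivity) hlow 2
  rw [hsq, div_pow] at h4
  have h5 : (2 : ℝ) ^ 2 / (N : ℝ) ^ 2 = 2 * (2 / (N : ℝ) ^ 2) := by ring
  linarith

/-- The eigenvalue defect of a character of the torus for the torus part of the walk. -/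
noncomputable def charGap {d N : ℕ} (χ : AddChar (Torus d N) ℂ) : ℝ :=
  ∑ i : Fin d, (1 - (χ (Pi.single i 1)).re)

lemma addChar_eq_zero_of_single {d N : ℕ} [NeZero N] {χ : AddChar (Torus d N) ℂ}
    (h : ∀ i, χ (Pi.single i 1) = 1) : χ = 0 := by
  ext y
  have hy : y = ∑ i, (y i).val • (Pi.single i 1 : Torus d N) := by
    conv_lhs => rw [← Finset.univ_sum_single y]
    refine Finset.sum_congr rfl fun i _ => ?_
    rw [← Pi.single_smul]
    simp
  have hprod : ∀ (s : Finset (Fin d)) (f : Fin d → Torus d N), (∀ i, χ (f i) = 1) →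
      χ (∑ i ∈ s, f i) = 1 := by
    intro s f hf
    induction s using Finset.cons_induction with
    | empty => simp
    | cons i s hi ih => rw [Finset.sum_cons, AddChar.map_add_eq_mul, hf, ih, one_mul]
  rw [hy, hprod _ _ fun i => by rw [AddChar.map_nsmul_eq_pow, h, one_pow], AddChar.zero_apply]

/-- A nontrivial character differs from 1 on some coordinate generator, where its value is an `N`-th
root of unity; the other coordinates contribute nonnegative terms. -/
lemma two_div_sq_le_charGap {d N : ℕ} [NeZero N] {χ : AddChar (Torus d N) ℂ} (hχ : χ ≠ 0) :
    2 / (N : ℝ) ^ 2 ≤ charGap χ := by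
  obtain ⟨i, hi⟩ : ∃ i, χ (Pi.single i 1) ≠ 1 := by
    by_contra! h
    exact hχ (addChar_eq_zero_of_single h)
  have hpow : χ (Pi.single i 1) ^ N = 1 := by
    rw [← AddChar.map_nsmul_eq_pow, ← Pi.single_smul]
    simp
  refine (two_div_sq_le_one_sub_re (NeZero.pos N) hpow hi).trans ?_
  refine Finset.single_le_sum (f := fun i => 1 - (χ (Pi.single i 1)).re) (fun j _ => ?_)
    (Finset.mem_univ i)
  have := (Complex.re_le_norm (χ (Pi.single j 1))).trans_eq (AddChar.norm_apply χ _)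
  simpa using this

/-! ### A comparison principle -/

/-- The function `cosh (t (z - z₀))` satisfies the recurrence with equality. Normalised to be 1 at
distance `L`, it dominates `ψ` there, and the maximum principle carries the domination to the
centre. -/
lemma le_inv_cosh_of_subharmonic {ψ : ℤ → ℝ} {t : ℝ} (ht : 0 < t) {z₀ : ℤ} {L : ℕ}
    (h1 : ∀ z, ψ z ≤ 1)
    (h2 : ∀ z, |z - z₀| < L → 2 * Real.cosh t * ψ z ≤ ψ (z + 1) + ψ (z - 1)) :
    ψ z₀ ≤ (Real.cosh (t * L))⁻¹ := by
  set D : ℤ → ℝ := fun z => ψ z - Real.cosh (t * (z - z₀)) / Real.cosh (t * L) with hD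
  have hc : 0 < Real.cosh (t * L) := Real.cosh_pos _
  have hsub : ∀ z, |z - z₀| < L → 2 * Real.cosh t * D z ≤ D (z + 1) + D (z - 1) := by
    intro z hz
    have e : Real.cosh (t * ((z + 1 : ℤ) - z₀)) + Real.cosh (t * ((z - 1 : ℤ) - z₀)) =
        2 * Real.cosh t * Real.cosh (t * (z - z₀)) := by
      push_cast
      rw [show t * ((z : ℝ) + 1 - z₀) = t * (z - z₀) + t by ring,
        show t * ((z : ℝ) - 1 - z₀) = t * (z - z₀) - t by ring, Real.cosh_add, Real.cosh_sub]
      ring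
    have := h2 z hz
    simp only [hD]
    have e2 : 2 * Real.cosh t * (Real.cosh (t * (z - z₀)) / Real.cosh (t * L)) =
        Real.cosh (t * ((z + 1 : ℤ) - z₀)) / Real.cosh (t * L) +
          Real.cosh (t * ((z - 1 : ℤ) - z₀)) / Real.cosh (t * L) := by
      rw [← add_div, e]; ring
    rw [mul_sub, e2]
    linarith
  have hbd : ∀ z, |z - z₀| = L → D z ≤ 0 := by
    intro z hz
    have : Real.cosh (t * (z - z₀)) = Real.cosh (t * L) := by
      rw [← Real.cosh_abs, abs_mul, abs_of_pos ht]
      congr 2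
      exact_mod_cast hz
    simp only [hD, this, div_self hc.ne']
    linarith [h1 z]
  obtain ⟨m, hm, hmax⟩ := Finset.exists_max_image (Finset.Icc (z₀ - L) (z₀ + L)) D
    ⟨z₀, by simp⟩
  have hle : D m ≤ 0 := by
    rw [Finset.mem_Icc] at hm
    by_cases hb : |m - z₀| = L
    · exact hbd m hb
    · have hlt : |m - z₀| < L :=
        lt_of_le_of_ne (abs_le.2 ⟨by omega, by omega⟩) hb
      have h3 := hsub m hlt
      rw [abs_lt] at hlt
      have h4 := hmax (m + 1) (Finset.mem_Icc.2 ⟨by omega, by omega⟩)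
      have h5 := hmax (m - 1) (Finset.mem_Icc.2 ⟨by omega, by omega⟩)
      -- At a positive interior maximum the inequality would read `2 cosh t · D m ≤ 2 · D m`, which
      -- `cosh t > 1` forbids.
      have h6 : 1 < Real.cosh t := Real.one_lt_cosh.2 ht.ne'
      by_contra hpos
      rw [not_le] at hpos
      nlinarith
  have h7 := (hmax z₀ (by simp)).trans hle
  simp only [hD, sub_self, mul_zero, Real.cosh_zero] at h7
  rw [← one_div]
  linarith

/-- Together with the gap `2 / N²` this allows the rate `t = 1 / N` in the comparison principle. -/
lemma cosh_inv_le {N : ℕ} (hN : 0 < N) : Real.cosh (N : ℝ)⁻¹ ≤ 1 + 2 / (N : ℝ) ^ 2 := by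
  have hNR : (1 : ℝ) ≤ N := by exact_mod_cast hN
  have h1 : ((N : ℝ)⁻¹) ^ 2 / 2 ≤ 1 := by
    have : (N : ℝ)⁻¹ ≤ 1 := inv_le_one_of_one_le₀ hNR
    have h0 : 0 ≤ (N : ℝ)⁻¹ := by positivity
    nlinarith
  have h2 := Real.abs_exp_sub_one_le (x := ((N : ℝ)⁻¹) ^ 2 / 2)
    (by rwa [abs_of_nonneg (by positivity)])
  rw [abs_of_nonneg (by positivity : (0 : ℝ) ≤ ((N : ℝ)⁻¹) ^ 2 / 2)] at h2
  have h3 := (Real.cosh_le_exp_half_sq (N : ℝ)⁻¹)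
  have h4 := (le_abs_self _).trans h2
  have h5 : ((N : ℝ)⁻¹) ^ 2 = 1 / (N : ℝ) ^ 2 := by rw [inv_pow, one_div]
  have h6 : 2 / (N : ℝ) ^ 2 = 2 * (1 / (N : ℝ) ^ 2) := by ring
  have h7 : 0 ≤ 1 / (N : ℝ) ^ 2 := by positivity
  rw [h5] at h3 h4
  rw [h6]
  linarith

/-! ### The entrance distribution -/

lemma integral_stepLaw {d N : ℕ} (f : Cyl d N → ℂ) :
    ∫ s, f s ∂stepLaw d N = (2 * ((d : ℂ) + 1))⁻¹ * ∑ s, f (unitStep d N s) := by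
  let : MeasurableSpace (Option (Fin d) × Bool) := ⊤
  have : MeasurableSingletonClass (Option (Fin d) × Bool) := ⟨fun _ => trivial⟩
  rw [stepLaw, ← PMF.toMeasure_map _ _ Measurable.of_discrete,
    integral_map Measurable.of_discrete.aemeasurable
      (Measurable.of_discrete.aestronglyMeasurable), PMF.integral_eq_sum, Finset.mul_sum]
  refine Finset.sum_congr rfl fun s _ => ?_
  have hc : Fintype.card (Option (Fin d) × Bool) = 2 * (d + 1) := by
    simp [Fintype.card_prod, mul_comm]
  rw [PMF.uniformOfFintype_apply, hc, ENNReal.toReal_inv, ENNReal.toReal_natCast]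
  simp

/-- The position of the path at the first return time. -/
noncomputable def entrance {d N : ℕ} (C O : Set ℤ) (x : Cyl d N) (ξ : ℕ → Cyl d N) : Cyl d N :=
  atTime (path x ξ) (ret C O (vert (path x ξ)) 1)

@[fun_prop]
lemma measurable_entrance {d N : ℕ} (C O : Set ℤ) (x : Cyl d N) :
    Measurable (entrance C O x) :=
  measurable_atTime (by fun_prop) (by fun_prop)

lemma entrance_add_left {d N : ℕ} (C O : Set ℤ) (y : Torus d N) (x : Cyl d N)
    (ξ : ℕ → Cyl d N) : entrance C O ((y, 0) + x) ξ = (y, 0) + entrance C O x ξ := by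
  unfold entrance
  rw [vert_path_congr (x' := x) (by simp)]
  exact path_add_left y x ξ _

/-- A start outside `C` cannot be the entrance point, so the first step can be split off. -/
lemma entrance_glue_one {d N : ℕ} {C O : Set ℤ} (hC : TwoSided C) {x : Cyl d N} (hx : x.2 ∉ C)
    (u : ℕ → Cyl d N) {v : ℕ → Cyl d N} (hv : v ∈ recurrentSteps d N) :
    entrance C O x (glue 1 (u, v)) = entrance C O (x + u 0) v := by
  have hp : path x u 1 = x + u 0 := by simp [path]
  have h0 : vert (path x (glue 1 (u, v))) 0 ∉ C := by simpa [vert] using hx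
  have h1 : ret C O (vert (path x (glue 1 (u, v)))) 1 =
      ((1 : ℕ) : ℕ∞) + ret C O (vert (path (x + u 0) v)) 1 := by
    have := firstTimeFrom_shift (vert (path x (glue 1 (u, v)))) C 1 0
    rw [vert_path_glue_add, hp] at this
    change firstTimeFrom _ C 0 = _ + firstTimeFrom _ C 0
    rw [← this]
    refine le_antisymm (le_iInf₂ fun n hn => iInf₂_le n ⟨zero_le, hn.2⟩)
      (le_iInf₂ fun n hn => iInf₂_le n ⟨?_, hn.2⟩)
    have : n ≠ 0 := by
      rintro rfl
      exact h0 hn.2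
    rw [add_zero]
    exact_mod_cast Nat.one_le_iff_ne_zero.2 this
  have hfin : ret C O (vert (path (x + u 0) v)) 1 ≠ ⊤ :=
    firstTimeFrom_ne_top hv hC _ ENat.zero_ne_top
  unfold entrance
  rw [h1, atTime_coe_add _ _ hfin]
  congr 1
  ext m : 1
  rw [path_glue_add, hp]

/-- The Fourier transform, along the torus, of the entrance distribution at height `a`. -/
noncomputable def entranceChar {d N : ℕ} (C O : Set ℤ) (χ : AddChar (Torus d N) ℂ) (a : ℤ)
    (x : Cyl d N) : ℂ :=
  ∫ ξ, (if (entrance C O x ξ).2 = a then χ (entrance C O x ξ).1 else 0) ∂stepsLaw d N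

lemma norm_entranceChar_le {d N : ℕ} [NeZero N] (C O : Set ℤ) (χ : AddChar (Torus d N) ℂ) (a : ℤ)
    (x : Cyl d N) :
    ‖entranceChar C O χ a x‖ ≤ (stepsLaw d N).real {ξ | (entrance C O x ξ).2 = a} := by
  have hm : MeasurableSet {ξ | (entrance C O x ξ).2 = a} :=
    (measurable_snd.comp (measurable_entrance C O x)) (measurableSet_singleton a)
  refine (norm_integral_le_integral_norm _).trans_eq ?_
  rw [← integral_indicator_one hm]
  refine integral_congr_ae (Eventually.of_forall fun ξ => ?_)
  by_cases h : (entrance C O x ξ).2 = a <;> simp [h, Set.indicator]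

lemma entranceChar_add_left {d N : ℕ} (C O : Set ℤ) (χ : AddChar (Torus d N) ℂ) (a : ℤ)
    (y : Torus d N) (x : Cyl d N) :
    entranceChar C O χ a ((y, 0) + x) = χ y * entranceChar C O χ a x := by
  unfold entranceChar
  rw [← integral_const_mul]
  congr 1
  ext ξ
  rw [entrance_add_left]
  simp [AddChar.map_add_eq_mul]

lemma entranceChar_eq_integral {d N : ℕ} [NeZero N] {C : Set ℤ} (O : Set ℤ) (hC : TwoSided C)
    (χ : AddChar (Torus d N) ℂ) (a : ℤ) {x : Cyl d N} (hx : x.2 ∉ C) :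
    entranceChar C O χ a x = ∫ s, entranceChar C O χ a (x + s) ∂stepLaw d N := by
  set f : Cyl d N → ℂ := fun r => if r.2 = a then χ r.1 else 0 with hf
  have hfm : Measurable f := Measurable.of_discrete
  have hfb : ∀ r, ‖f r‖ ≤ 1 := by
    intro r
    by_cases h : r.2 = a <;> simp [hf, h]
  have hglue : MeasurePreserving (glue 1) ((stepsLaw d N).prod (stepsLaw d N)) (stepsLaw d N) :=
    measurePreserving_glue (stepLaw d N) 1
  have h1 : entranceChar C O χ a x =
      ∫ p, f (entrance C O x (glue 1 p)) ∂(stepsLaw d N).prod (stepsLaw d N) := by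
    rw [← integral_map (f := fun ξ => f (entrance C O x ξ)) hglue.measurable.aemeasurable
      (hfm.comp (measurable_entrance C O x)).aestronglyMeasurable, hglue.map_eq]
    rfl
  have hint : Integrable (fun p => f (entrance C O x (glue 1 p)))
      ((stepsLaw d N).prod (stepsLaw d N)) :=
    Integrable.of_bound ((hfm.comp (measurable_entrance C O x)).comp
      hglue.measurable).aestronglyMeasurable 1 (Eventually.of_forall fun p => hfb _)
  rw [h1, integral_prod _ hint]
  have h2 : ∀ u : ℕ → Cyl d N, ∫ v, f (entrance C O x (glue 1 (u, v))) ∂stepsLaw d N =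
      entranceChar C O χ a (x + u 0) := by
    intro u
    refine integral_congr_ae ?_
    filter_upwards [ae_recurrentSteps d N] with v hv
    rw [entrance_glue_one hC hx u hv]
  simp only [h2]
  have h3 := measurePreserving_eval_infinitePi (fun _ : ℕ => stepLaw d N) 0
  conv_rhs => rw [← h3.map_eq]
  rw [integral_map h3.measurable.aemeasurable Measurable.of_discrete.aestronglyMeasurable]

/-- In the one-step equation a torus step `y` multiplies the value by `χ y`. The `2 d` torus steps
contribute `2 ∑ Re χ(eᵢ) = 2 d - 2 charGap χ` times the value at `z`, and moving this term to the
left leaves the two vertical steps. -/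
lemma entranceChar_recurrence {d N : ℕ} [NeZero N] {C : Set ℤ} (O : Set ℤ) (hC : TwoSided C)
    (χ : AddChar (Torus d N) ℂ) (a : ℤ) {z : ℤ} (hz : z ∉ C) :
    (2 * (1 + charGap χ) : ℝ) * entranceChar C O χ a (0, z) =
      entranceChar C O χ a (0, z + 1) + entranceChar C O χ a (0, z - 1) := by
  have h := entranceChar_eq_integral O hC χ a (x := ((0, z) : Cyl d N)) hz
  rw [integral_stepLaw, Fintype.sum_prod_type] at h
  simp only [Fintype.sum_bool, Fintype.sum_option] at h
  have hs : ∀ y : Torus d N, entranceChar C O χ a ((0, z) + (y, 0)) =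
      χ y * entranceChar C O χ a (0, z) := by
    intro y
    rw [add_comm, entranceChar_add_left]
  have hd : (2 * ((d : ℂ) + 1)) ≠ 0 := by
    have : ((d : ℂ) + 1) ≠ 0 := Nat.cast_add_one_ne_zero d
    exact mul_ne_zero two_ne_zero this
  have hre : ∀ i : Fin d, χ (Pi.single i 1) + χ (Pi.single i (-1)) =
      ((2 * (χ (Pi.single i 1)).re : ℝ) : ℂ) := by
    intro i
    rw [Pi.single_neg, AddChar.map_neg_eq_conj, Complex.add_conj]
  simp only [unitStep, if_true, Bool.false_eq_true, if_false, hs, ← add_mul, hre] at h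
  rw [eq_inv_mul_iff_mul_eq₀ hd, ← Finset.sum_mul] at h
  simp only [Prod.mk_add_mk, add_zero, ← sub_eq_add_neg] at h
  have hg : ((charGap χ : ℝ) : ℂ) = d - ∑ i, (((χ (Pi.single i 1)).re : ℝ) : ℂ) := by
    simp [charGap]
  push_cast at h ⊢
  rw [hg]
  rw [← Finset.mul_sum] at h
  linear_combination h

/-- The sum over heights is taken before the comparison: entrances at different heights are disjoint
events, so the sum is still at most 1 and the bound does not depend on `A`. -/
lemma sum_norm_entranceChar_le {d N : ℕ} [NeZero N] {C : Set ℤ} (O : Set ℤ) (hC : TwoSided C)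
    {χ : AddChar (Torus d N) ℂ} (hχ : χ ≠ 0) (A : Finset ℤ) {x : Cyl d N} {L : ℕ}
    (hL : ∀ z, |z - x.2| < L → z ∉ C) :
    ∑ a ∈ A, ‖entranceChar C O χ a x‖ ≤ (Real.cosh ((N : ℝ)⁻¹ * L))⁻¹ := by
  set ψ : ℤ → ℝ := fun z => ∑ a ∈ A, ‖entranceChar C O χ a ((0, z) : Cyl d N)‖ with hψ
  have hx : ∑ a ∈ A, ‖entranceChar C O χ a x‖ = ψ x.2 := by
    refine Finset.sum_congr rfl fun a _ => ?_
    have : x = (x.1, 0) + ((0, x.2) : Cyl d N) := by simp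
    conv_lhs => rw [this, entranceChar_add_left]
    simp
  rw [hx]
  refine le_inv_cosh_of_subharmonic (by have := NeZero.pos N; positivity) (fun z => ?_)
    fun z hz => ?_
  · calc ψ z ≤ ∑ a ∈ A, (stepsLaw d N).real {ξ | (entrance C O ((0, z) : Cyl d N) ξ).2 = a} :=
          Finset.sum_le_sum fun a _ => norm_entranceChar_le _ _ _ _ _
      _ = (stepsLaw d N).real
            (⋃ a ∈ A, {ξ | (entrance C O ((0, z) : Cyl d N) ξ).2 = a}) := by
          rw [measureReal_biUnion_finset]
          · intro a _ b _ hab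
            exact Set.disjoint_left.2 fun ξ h1 h2 => hab (h1.symm.trans h2)
          · intro a _
            exact (measurable_snd.comp (measurable_entrance C O _)) (measurableSet_singleton a)
      _ ≤ 1 := measureReal_le_one
  · have h1 : 2 * (1 + charGap χ) * ψ z ≤ ψ (z + 1) + ψ (z - 1) := by
      simp only [hψ]
      rw [Finset.mul_sum, ← Finset.sum_add_distrib]
      refine Finset.sum_le_sum fun a _ => ?_
      have hg : 0 ≤ charGap χ := le_trans (by positivity) (two_div_sq_le_charGap hχ)
      calc 2 * (1 + charGap χ) * ‖entranceChar C O χ a ((0, z) : Cyl d N)‖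
          = ‖((2 * (1 + charGap χ) : ℝ) : ℂ) * entranceChar C O χ a ((0, z) : Cyl d N)‖ := by
            rw [norm_mul, Complex.norm_real, Real.norm_of_nonneg (by positivity)]
        _ ≤ _ := by
            rw [entranceChar_recurrence O hC χ a (hL z hz)]
            exact norm_add_le _ _
    refine le_trans ?_ h1
    refine mul_le_mul_of_nonneg_right ?_ (Finset.sum_nonneg fun _ _ => norm_nonneg _)
    have := (cosh_inv_le (NeZero.pos N)).trans
      (add_le_add_right (two_div_sq_le_charGap hχ) 1)
    linarith

lemma entranceChar_eq_sum {d N : ℕ} [NeZero N] (C O : Set ℤ) (χ : AddChar (Torus d N) ℂ) (a : ℤ)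
    (x : Cyl d N) :
    entranceChar C O χ a x =
      ∑ y : Torus d N, ((stepsLaw d N).real {ξ | entrance C O x ξ = (y, a)} : ℂ) * χ y := by
  have hm : ∀ y : Torus d N, MeasurableSet {ξ | entrance C O x ξ = (y, a)} := fun y =>
    (measurable_entrance C O x) (measurableSet_singleton _)
  have h1 : ∀ ξ, (if (entrance C O x ξ).2 = a then χ (entrance C O x ξ).1 else 0) =
      ∑ y : Torus d N, {ξ | entrance C O x ξ = (y, a)}.indicator (fun _ => χ y) ξ := by
    intro ξ
    simp only [Set.indicator, Set.mem_ofPred_eq, Prod.ext_iff]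
    by_cases h : (entrance C O x ξ).2 = a <;> simp [h]
  unfold entranceChar
  simp only [h1]
  rw [integral_finsetSum]
  · refine Finset.sum_congr rfl fun y _ => ?_
    rw [integral_indicator_const _ (hm y)]
    simp
  · intro y _
    exact (integrable_const _).indicator (hm y)

/-- Fourier inversion: the trivial character yields the mean, so each pointwise deviation is at most
the sum over the nontrivial characters divided by the number of points. Summing over the points
cancels this division. -/
lemma sum_abs_entrance_sub_le {d N : ℕ} [NeZero N] (C O : Set ℤ) (a : ℤ) (x : Cyl d N) :
    ∑ y : Torus d N, |(stepsLaw d N).real {ξ | entrance C O x ξ = (y, a)} -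
      (∑ y' : Torus d N, (stepsLaw d N).real {ξ | entrance C O x ξ = (y', a)}) /
        Fintype.card (Torus d N)| ≤
      ∑ χ : AddChar (Torus d N) ℂ with χ ≠ 0, ‖entranceChar C O χ a x‖ := by
  set p : Torus d N → ℝ := fun y => (stepsLaw d N).real {ξ | entrance C O x ξ = (y, a)} with hp
  set n : ℝ := (Fintype.card (Torus d N) : ℝ) with hn
  have hn0 : 0 < n := by
    rw [hn]; exact_mod_cast Fintype.card_pos
  have hzero : entranceChar C O (0 : AddChar (Torus d N) ℂ) a x = ((∑ y, p y : ℝ) : ℂ) := by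
    rw [entranceChar_eq_sum]
    simp [hp]
  have hinv : ∀ y, ((n * p y : ℝ) : ℂ) =
      ∑ χ : AddChar (Torus d N) ℂ, χ (-y) * entranceChar C O χ a x := by
    intro y
    simp only [entranceChar_eq_sum, Finset.mul_sum]
    rw [Finset.sum_comm]
    have : ∀ y', ∑ χ : AddChar (Torus d N) ℂ, χ (-y) * ((p y' : ℂ) * χ y') =
        if y' = y then ((n * p y : ℝ) : ℂ) else 0 := by
      intro y'
      have h1 : ∀ χ : AddChar (Torus d N) ℂ, χ (-y) * ((p y' : ℂ) * χ y') =
          (p y' : ℂ) * χ (y' - y) := by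
        intro χ
        rw [sub_eq_add_neg, AddChar.map_add_eq_mul]
        ring
      simp only [h1, ← Finset.mul_sum, AddChar.sum_apply_eq_ite, sub_eq_zero]
      split_ifs with h
      · rw [h, hn]; push_cast; ring
      · simp
    rw [Finset.sum_congr rfl fun y' _ => this y']
    simp
  have hy : ∀ y, |p y - (∑ y', p y') / n| ≤
      n⁻¹ * ∑ χ : AddChar (Torus d N) ℂ with χ ≠ 0, ‖entranceChar C O χ a x‖ := by
    intro y
    have h1 : ((n * (p y - (∑ y', p y') / n) : ℝ) : ℂ) =
        ∑ χ : AddChar (Torus d N) ℂ with χ ≠ 0, χ (-y) * entranceChar C O χ a x := by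
      have h2 := hinv y
      rw [← Finset.sum_filter_add_sum_filter_not _ (fun χ => χ ≠ 0)] at h2
      simp only [not_not, Finset.filter_eq', Finset.mem_univ, if_true, Finset.sum_singleton,
        AddChar.zero_apply, one_mul, hzero] at h2
      rw [mul_sub, mul_div_cancel₀ _ hn0.ne', Complex.ofReal_sub, h2]
      ring
    have h3 : n * |p y - (∑ y', p y') / n| ≤
        ∑ χ : AddChar (Torus d N) ℂ with χ ≠ 0, ‖entranceChar C O χ a x‖ := by
      rw [← abs_of_pos hn0, ← abs_mul, ← Real.norm_eq_abs, ← Complex.norm_real, abs_of_pos hn0, h1]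
      refine (norm_sum_le _ _).trans (Finset.sum_le_sum fun χ _ => ?_)
      rw [norm_mul, AddChar.norm_apply, one_mul]
    rw [inv_mul_eq_div, le_div_iff₀ hn0, mul_comm]
    exact h3
  refine (Finset.sum_le_sum fun y _ => hy y).trans_eq ?_
  rw [Finset.sum_const, Finset.card_univ, nsmul_eq_mul, ← mul_assoc, ← hn,
    mul_inv_cancel₀ hn0.ne', one_mul]

/-- The entrance distribution is close to being uniform along the torus. -/
lemma sum_sum_abs_entrance_sub_le {d N : ℕ} [NeZero N] {C : Set ℤ} (O : Set ℤ) (hC : TwoSided C)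
    (A : Finset ℤ) {x : Cyl d N} {L : ℕ} (hL : ∀ z, |z - x.2| < L → z ∉ C) :
    ∑ a ∈ A, ∑ y : Torus d N, |(stepsLaw d N).real {ξ | entrance C O x ξ = (y, a)} -
      (∑ y' : Torus d N, (stepsLaw d N).real {ξ | entrance C O x ξ = (y', a)}) /
        Fintype.card (Torus d N)| ≤ (N : ℝ) ^ d * (Real.cosh ((N : ℝ)⁻¹ * L))⁻¹ := by
  refine (Finset.sum_le_sum fun a _ => sum_abs_entrance_sub_le C O a x).trans ?_
  rw [Finset.sum_comm]
  refine (Finset.sum_le_sum fun χ hχ =>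
    sum_norm_entranceChar_le O hC (Finset.mem_filter.1 hχ).2 A hL).trans ?_
  rw [Finset.sum_const, nsmul_eq_mul]
  refine mul_le_mul_of_nonneg_right ?_ (inv_nonneg.2 (Real.cosh_pos _).le)
  have h1 : (Finset.univ.filter fun χ : AddChar (Torus d N) ℂ => χ ≠ 0).card ≤ N ^ d := by
    refine (Finset.card_le_univ _).trans_eq ?_
    rw [AddChar.card_eq]
    simp [ZMod.card]
  exact_mod_cast h1

/-! ### Coupling a finite measure with the uniform one -/

/-- Maximal coupling, for a measure that need not be normalised. With `u` the average, the mass `min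
(p y) u` stays at `y` and the excess `p y - u` is distributed in proportion to the deficits `u - p
y'`. Total excess and total deficit agree, since `p` and the constant `u` have the same sum. -/
lemma exists_coupling_uniform {T : Type*} [Fintype T] [Nonempty T] (p : T → ℝ≥0∞)
    (hp : ∀ y, p y ≠ ⊤) :
    ∃ K : T → PMF T, (∀ y', ∑ y, p y * K y y' = (∑ y, p y) / Fintype.card T) ∧
      ∀ y, p y * (1 - K y y) ≤ p y - (∑ y', p y') / Fintype.card T := by
  classical
  set u : ℝ≥0∞ := (∑ y, p y) / Fintype.card T with hu
  have hcard0 : (Fintype.card T : ℝ≥0∞) ≠ 0 := by exact_mod_cast Fintype.card_ne_zero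
  have hsum : ∑ y, p y ≠ ⊤ := ENNReal.sum_ne_top.2 fun y _ => hp y
  have hu_top : u ≠ ⊤ := ENNReal.div_ne_top hsum hcard0
  have hsum_u : ∑ y, p y = ∑ _y : T, u := by
    rw [Finset.sum_const, Finset.card_univ, nsmul_eq_mul, hu,
      ENNReal.mul_div_cancel hcard0 (ENNReal.natCast_ne_top _)]
  set ρ : ℝ≥0∞ := ∑ y, (u - p y) with hρ
  have hmp : ∀ y, min (p y) u + (p y - u) = p y := fun y => by
    rcases le_total (p y) u with h | h <;> simp [h, tsub_eq_zero_of_le]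
  have hmu : ∀ y, min (p y) u + (u - p y) = u := fun y => by
    rcases le_total (p y) u with h | h <;> simp [h, tsub_eq_zero_of_le]
  have hm_top : ∑ y, min (p y) u ≠ ⊤ :=
    ENNReal.sum_ne_top.2 fun y _ => ne_top_of_le_ne_top (hp y) (min_le_left _ _)
  have hρ' : ∑ y, (p y - u) = ρ := by
    have : ∑ y, min (p y) u + ∑ y, (p y - u) = ∑ y, min (p y) u + ρ := by
      rw [hρ, ← Finset.sum_add_distrib, ← Finset.sum_add_distrib]
      simp only [hmp, hmu]
      exact hsum_u
    exact (ENNReal.add_right_inj hm_top).1 this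
  have hρ_top : ρ ≠ ⊤ := ENNReal.sum_ne_top.2 fun y _ => ENNReal.sub_ne_top hu_top
  have hex : ∀ y, ∃ κ : PMF T, ∀ y',
      p y * κ y' = (if y' = y then min (p y) u else 0) + (p y - u) * ((u - p y') / ρ) := by
    intro y
    -- Without excess nothing moves. This branch also covers `p y = 0`, where the formula does not
    -- determine the kernel.
    by_cases he : p y - u = 0
    · refine ⟨PMF.pure y, fun y' => ?_⟩
      have : min (p y) u = p y := min_eq_left (tsub_eq_zero_iff_le.1 he)
      rw [he, zero_mul, add_zero, this, PMF.pure_apply]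
      split_ifs <;> simp
    · have hp0 : p y ≠ 0 := fun h => he (by simp [h])
      have hρ0 : ρ ≠ 0 := by
        rw [← hρ']
        exact fun h => he (Finset.sum_eq_zero_iff.1 h y (Finset.mem_univ y))
      refine ⟨PMF.ofFintype (fun y' => (p y)⁻¹ *
        ((if y' = y then min (p y) u else 0) + (p y - u) * ((u - p y') / ρ))) ?_, fun y' => ?_⟩
      · rw [← Finset.mul_sum, Finset.sum_add_distrib, ← Finset.mul_sum]
        simp only [div_eq_mul_inv]
        rw [← Finset.sum_mul, ENNReal.mul_inv_cancel hρ0 hρ_top, mul_one, Finset.sum_ite_eq',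
          if_pos (Finset.mem_univ y), hmp, ENNReal.inv_mul_cancel hp0 (hp y)]
      · rw [PMF.ofFintype_apply, ← mul_assoc, ENNReal.mul_inv_cancel hp0 (hp y), one_mul]
  choose K hK using hex
  refine ⟨K, fun y' => ?_, fun y => ?_⟩
  · simp only [hK]
    rw [Finset.sum_add_distrib, ← Finset.sum_mul, hρ', Finset.sum_ite_eq,
      if_pos (Finset.mem_univ y')]
    by_cases hρ0 : ρ = 0
    · have : u - p y' = 0 := Finset.sum_eq_zero_iff.1 hρ0 y' (Finset.mem_univ y')
      rw [hρ0, zero_mul, ← this]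
      exact hmu y'
    · rw [ENNReal.mul_div_cancel hρ0 hρ_top]
      exact hmu y'
  · rw [ENNReal.mul_sub fun _ _ => hp y, mul_one, hK, if_pos rfl]
    refine (tsub_le_tsub_left le_self_add _).trans ?_
    rcases le_total (p y) u with h | h <;> simp [h, tsub_eq_zero_of_le]

/-! ### Auxiliary randomness and corrected excursions -/

/-- The law of the corrected entrance position of the walk started at `x`, given that the
entrance position is `r`. -/
noncomputable def couplingKernel {d N : ℕ} [NeZero N] (C O : Set ℤ) (x r : Cyl d N) :
    PMF (Torus d N) :=
  (exists_coupling_uniform (fun y : Torus d N => stepsLaw d N {ξ | entrance C O x ξ = (y, r.2)})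
    fun _ => measure_ne_top _ _).choose r.1

/-- The law of the auxiliary randomness used for one excursion: an independent corrected
entrance position for every pair of a starting point and an entrance point. -/
noncomputable def auxLaw (d N : ℕ) [NeZero N] (C O : Set ℤ) :
    Measure (Cyl d N × Cyl d N → Torus d N) :=
  Measure.infinitePi fun i => (couplingKernel C O i.1 i.2).toMeasure

instance auxLaw_isProbabilityMeasure (d N : ℕ) [NeZero N] (C O : Set ℤ) :
    IsProbabilityMeasure (auxLaw d N C O) := by
  unfold auxLaw
  infer_instance

/-- The joint law of the steps and of the auxiliary randomness. -/
noncomputable abbrev noiseLaw (d N : ℕ) [NeZero N] (C O : Set ℤ) :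
    Measure ((ℕ → Cyl d N) × (ℕ → Cyl d N × Cyl d N → Torus d N)) :=
  (stepsLaw d N).prod (Measure.infinitePi fun _ : ℕ => auxLaw d N C O)

/-- The torus part of the corrected excursion of `w` after its `k`-th departure. -/
noncomputable def coupledTorus {d N : ℕ} (C O : Set ℤ) (w : ℕ → Cyl d N) (k : ℕ)
    (u : Cyl d N × Cyl d N → Torus d N) : ℕ → Torus d N :=
  fun n => excursion (fun m => (w m).1) (ret C O (vert w) (k + 1)) (dep C O (vert w) (k + 1)) n -
    (atTime w (ret C O (vert w) (k + 1))).1 +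
      u (atTime w (dep C O (vert w) k), atTime w (ret C O (vert w) (k + 1)))

/-- The corrected excursion of `w` after its `k`-th departure. -/
noncomputable def coupledExcursion {d N : ℕ} (C O : Set ℤ) (w : ℕ → Cyl d N) (k : ℕ)
    (u : Cyl d N × Cyl d N → Torus d N) : ℕ → Cyl d N :=
  auxExcursion C O (k + 1) (coupledTorus C O w k u) (vert w)

/-- The paths whose vertical component is at `b` at the first departure, and whose stopped path
is in `A`. -/
def stoppedSet {d N : ℕ} (C O : Set ℤ) (b : ℤ) (A : Set (ℕ → Cyl d N)) : Set (ℕ → Cyl d N) :=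
  {w | atTime (vert w) (dep C O (vert w) 1) = b ∧ excursion w 0 (dep C O (vert w) 1) ∈ A}

/-- The event that the excursion of `w` after its `k`-th departure goes from `β.1` to `β.2`, and
that the corrected excursion is in `A`. -/
def ExcursionEvent {d N : ℕ} (C O : Set ℤ) (w : ℕ → Cyl d N) (k : ℕ)
    (u : Cyl d N × Cyl d N → Torus d N) (β : ℤ × ℤ) (A : Set (ℕ → Cyl d N)) : Prop :=
  (atTime (vert w) (ret C O (vert w) (k + 1)) = β.1 ∧
    atTime (vert w) (dep C O (vert w) (k + 1)) = β.2) ∧ coupledExcursion C O w k u ∈ A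

lemma measurable_coupledTorus {d N : ℕ} {Ω : Type*} [MeasurableSpace Ω] (C O : Set ℤ)
    {w : Ω → ℕ → Cyl d N} (hw : Measurable w) (k : ℕ) {u : Ω → Cyl d N × Cyl d N → Torus d N}
    (hu : Measurable u) : Measurable fun ω => coupledTorus C O (w ω) k (u ω) := by
  have hv : Measurable fun ω => vert (w ω) := measurable_vert.comp hw
  have hr : ∀ k, Measurable fun ω => ret C O (vert (w ω)) k := fun k =>
    (measurable_ret C O k).comp hv
  have hd : ∀ k, Measurable fun ω => dep C O (vert (w ω)) k := fun k =>
    (measurable_dep C O k).comp hv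
  have hfst : Measurable fun ω => fun m => (w ω m).1 :=
    measurable_pi_lambda _ fun m => measurable_fst.comp ((measurable_pi_apply m).comp hw)
  have heval : Measurable fun p : (Cyl d N × Cyl d N → Torus d N) × (Cyl d N × Cyl d N) =>
      p.1 p.2 := measurable_from_prod_countable_left fun i => measurable_pi_apply i
  have hcomb : Measurable fun p : Torus d N × Torus d N × Torus d N => p.1 - p.2.1 + p.2.2 :=
    Measurable.of_discrete
  refine measurable_pi_lambda _ fun n => ?_
  exact hcomb.comp (((measurable_pi_apply n).comp
    (measurable_excursion hfst (hr (k + 1)) (hd (k + 1)))).prodMk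
    ((measurable_fst.comp (measurable_atTime hw (hr (k + 1)))).prodMk
      (heval.comp (hu.prodMk ((measurable_atTime hw (hd k)).prodMk
        (measurable_atTime hw (hr (k + 1))))))))

lemma measurable_coupledExcursion {d N : ℕ} {Ω : Type*} [MeasurableSpace Ω] (C O : Set ℤ)
    {w : Ω → ℕ → Cyl d N} (hw : Measurable w) (k : ℕ) {u : Ω → Cyl d N × Cyl d N → Torus d N}
    (hu : Measurable u) : Measurable fun ω => coupledExcursion C O (w ω) k (u ω) := by
  have hv : Measurable fun ω => vert (w ω) := measurable_vert.comp hw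
  have hr : Measurable fun ω => ret C O (vert (w ω)) (k + 1) := (measurable_ret C O (k + 1)).comp hv
  have hd : Measurable fun ω => dep C O (vert (w ω)) (k + 1) := (measurable_dep C O (k + 1)).comp hv
  have h1 := measurable_coupledTorus C O hw k hu
  have h2 := measurable_excursion hv hr hd
  unfold coupledExcursion auxExcursion
  exact measurable_pi_lambda _ fun n => (measurable_pi_iff.1 h1 n).prodMk (measurable_pi_iff.1 h2 n)

lemma measurableSet_excursionEvent {d N : ℕ} {Ω : Type*} [MeasurableSpace Ω] (C O : Set ℤ)
    {w : Ω → ℕ → Cyl d N} (hw : Measurable w) (k : ℕ) {u : Ω → Cyl d N × Cyl d N → Torus d N}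
    (hu : Measurable u) (β : ℤ × ℤ) {A : Set (ℕ → Cyl d N)} (hA : MeasurableSet A) :
    MeasurableSet {ω | ExcursionEvent C O (w ω) k (u ω) β A} := by
  have hv : Measurable fun ω => vert (w ω) := measurable_vert.comp hw
  have hr : Measurable fun ω => ret C O (vert (w ω)) (k + 1) := (measurable_ret C O (k + 1)).comp hv
  have hd : Measurable fun ω => dep C O (vert (w ω)) (k + 1) := (measurable_dep C O (k + 1)).comp hv
  exact ((measurable_atTime hv hr (measurableSet_singleton β.1)).inter
    (measurable_atTime hv hd (measurableSet_singleton β.2))).inter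
    (measurable_coupledExcursion C O hw k hu hA)

lemma measurableSet_stoppedSet {d N : ℕ} (C O : Set ℤ) (b : ℤ) {A : Set (ℕ → Cyl d N)}
    (hA : MeasurableSet A) : MeasurableSet (stoppedSet C O b A) := by
  have hd : Measurable fun w : ℕ → Cyl d N => dep C O (vert w) 1 := by fun_prop
  exact (measurable_atTime measurable_vert hd (measurableSet_singleton b)).inter
    (measurable_excursion measurable_id measurable_const hd hA)

/-! ### The uniform law on a level -/

lemma tsum_cyl_eq_sum {d N : ℕ} [NeZero N] (a : ℤ) (f : Cyl d N → ℝ≥0∞)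
    (hf : ∀ r, r.2 ≠ a → f r = 0) : ∑' r, f r = ∑ y : Torus d N, f (y, a) := by
  rw [ENNReal.tsum_prod (f := fun y b => f (y, b)), tsum_fintype]
  exact Finset.sum_congr rfl fun y _ => tsum_eq_single a fun b hb => hf _ hb

lemma levelUniform_singleton {d N : ℕ} [NeZero N] (a : ℤ) (x : Cyl d N) :
    levelUniform d N a {x} = if x.2 = a then (Fintype.card (Torus d N) : ℝ≥0∞)⁻¹ else 0 := by
  have hm : MeasurableSet {x : Cyl d N | x.2 = a} := MeasurableSet.of_discrete
  have hcount : Measure.count {x : Cyl d N | x.2 = a} = Fintype.card (Torus d N) := by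
    have h1 : {x : Cyl d N | x.2 = a} =
        ((Finset.univ : Finset (Torus d N)).map ⟨fun y => (y, a), fun y y' h => by simpa using h⟩ :
          Finset (Cyl d N)) := by
      ext ⟨y, b⟩
      simp only [Set.mem_ofPred_eq, Finset.coe_map, Set.mem_image, Finset.coe_univ, Set.mem_univ,
        true_and]
      exact ⟨fun h => ⟨y, by rw [h]; rfl⟩, fun ⟨y', h⟩ => (congrArg Prod.snd h).symm⟩
    rw [h1, Measure.count_apply_finset, Finset.card_map, Finset.card_univ]
  rw [levelUniform, uniformOn, cond_apply hm, hcount]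
  split_ifs with h
  · rw [Set.inter_eq_right.2 (by simpa using h), Measure.count_singleton, mul_one]
  · have : {x : Cyl d N | x.2 = a} ∩ {x} = ∅ := Set.inter_singleton_eq_empty.2 h
    rw [this, measure_empty, mul_zero]

instance levelUniform_isProbabilityMeasure (d N : ℕ) [NeZero N] (a : ℤ) :
    IsProbabilityMeasure (levelUniform d N a) := by
  refine isProbabilityMeasure_uniformOn ?_ ⟨(0, a), rfl⟩
  exact (Set.finite_range fun y : Torus d N => (y, a)).subset fun x hx => ⟨x.1, by
    rw [← (hx : x.2 = a)]⟩

lemma lintegral_levelUniform {d N : ℕ} [NeZero N] (a : ℤ) (f : Cyl d N → ℝ≥0∞) :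
    ∫⁻ x, f x ∂levelUniform d N a = (∑ y : Torus d N, f (y, a)) / Fintype.card (Torus d N) := by
  rw [lintegral_countable', tsum_cyl_eq_sum a]
  · simp only [levelUniform_singleton, if_true]
    rw [← Finset.sum_mul, div_eq_mul_inv]
  · intro r hr
    rw [levelUniform_singleton, if_neg hr, mul_zero]

lemma walkLaw_apply {d N : ℕ} (μ₀ : Measure (Cyl d N)) [SFinite μ₀] {S : Set (ℕ → Cyl d N)}
    (hS : MeasurableSet S) :
    walkLaw d N μ₀ S = ∫⁻ x, stepsLaw d N {ξ | path x ξ ∈ S} ∂μ₀ := by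
  change Measure.map (fun p : Cyl d N × (ℕ → Cyl d N) => path p.1 p.2) _ S = _
  rw [Measure.map_apply measurable_path_prod hS, Measure.prod_apply (measurable_path_prod hS)]
  rfl

/-! ### One excursion -/

lemma vert_path_mk_snd {d N : ℕ} (r : Cyl d N) (y : Torus d N) (ξ : ℕ → Cyl d N) :
    vert (path (y, r.2) ξ) = vert (path r ξ) := vert_path_congr rfl ξ

/-- Translating an excursion amounts to moving its starting point: after the first return, the
corrected excursion is the walk driven by the fresh steps `ξ'` from the corrected entrance point,
stopped at its own first departure. -/
lemma excursionEvent_glue {d N : ℕ} {C O : Set ℤ} (hC : TwoSided C) (hO : TwoSided Oᶜ)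
    (x : Cyl d N) {n : ℕ} {ξ ξ' : ℕ → Cyl d N} (hξ' : ξ' ∈ recurrentSteps d N)
    (hn : ret C O (vert (path x ξ)) 1 = n) (u : Cyl d N × Cyl d N → Torus d N) (β : ℤ × ℤ)
    (A : Set (ℕ → Cyl d N)) :
    ExcursionEvent C O (path x (glue n (ξ, ξ'))) 0 u β A ↔
      (entrance C O x ξ).2 = β.1 ∧
        path (u (x, entrance C O x ξ), β.1) ξ' ∈ stoppedSet C O β.2 A := by
  set w := path x (glue n (ξ, ξ')) with hw
  set r := entrance C O x ξ with hr
  have hrn : r = path x ξ n := by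
    rw [hr, entrance, hn]; rfl
  have hret : ret C O (vert w) 1 = n :=
    (ret_one_eq_iff fun i hi => (vert_path_glue_of_le x hi (ξ, ξ')).symm).1 hn
  have hshift : (fun m => w (n + m)) = path r ξ' := by
    ext m : 1
    rw [hw, path_glue_add, hrn]
  have hvshift : (fun m => vert w (n + m)) = vert (path r ξ') := by
    rw [← hshift]; rfl
  set D := dep C O (vert (path r ξ')) 1 with hD
  have hDtop : D ≠ ⊤ := dep_ne_top hξ' hC hO r 1
  have hdep : dep C O (vert w) 1 = n + D := by
    rw [dep_one_of_ret_one hret, hvshift]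
  have hwn : w n = r := by
    have := congrFun hshift 0
    simpa using this
  have hzD : atTime (vert w) (dep C O (vert w) 1) = atTime (vert (path r ξ')) D := by
    rw [hdep, atTime_coe_add _ _ hDtop, hvshift]
  have hzR : atTime (vert w) (ret C O (vert w) 1) = r.2 := by
    rw [hret]
    change (w n).2 = r.2
    rw [hwn]
  have hexc : coupledExcursion C O w 0 u = excursion (path (u (x, r), r.2) ξ') 0 D := by
    have hatR : atTime w (ret C O (vert w) 1) = r := by
      rw [hret]; exact hwn
    have hatD : atTime w (dep C O (vert w) 0) = x := by
      change w 0 = x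
      simp [hw]
    ext m : 1
    change (excursion (fun m => (w m).1) (ret C O (vert w) 1) (dep C O (vert w) 1) m -
        (atTime w (ret C O (vert w) 1)).1 + u (atTime w (dep C O (vert w) 0),
          atTime w (ret C O (vert w) 1)),
      excursion (vert w) (ret C O (vert w) 1) (dep C O (vert w) 1) m) = _
    rw [hatR, hatD, hret, hdep]
    have e1 := excursion_coe_add (fun m => (w m).1) n ENat.zero_ne_top D
    have e2 := excursion_coe_add (vert w) n ENat.zero_ne_top D
    rw [add_zero] at e1 e2
    rw [e1, e2, hvshift]
    have e3 : (fun m => (w (n + m)).1) = fun m => (path r ξ' m).1 := by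
      rw [← hshift]
    rw [e3]
    have e4 : path (u (x, r), r.2) ξ' (min (0 + (m : ℕ∞)) D).toNat =
        (u (x, r) - r.1, 0) + path r ξ' (min (0 + (m : ℕ∞)) D).toNat := by
      rw [← path_add_left]
      congr 1
      ext <;> simp
    change ((path r ξ' (min (0 + (m : ℕ∞)) D).toNat).1 - r.1 + u (x, r),
      (path r ξ' (min (0 + (m : ℕ∞)) D).toNat).2) =
        path (u (x, r), r.2) ξ' (min (0 + (m : ℕ∞)) D).toNat
    rw [e4]
    ext1
    · simp only [Prod.fst_add]
      abel
    · simp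
  have hgoal : ExcursionEvent C O w 0 u β A ↔ (r.2 = β.1 ∧ atTime (vert (path r ξ')) D = β.2) ∧
      excursion (path (u (x, r), r.2) ξ') 0 D ∈ A := by
    unfold ExcursionEvent
    rw [zero_add, hzR, hzD, hexc]
  rw [hgoal]
  constructor
  · rintro ⟨⟨h1, h2⟩, h3⟩
    refine ⟨h1, ?_⟩
    rw [← h1]
    exact ⟨by rw [vert_path_mk_snd]; exact h2, by rw [vert_path_mk_snd]; exact h3⟩
  · rintro ⟨h1, h2, h3⟩
    rw [← h1, vert_path_mk_snd] at h2 h3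
    exact ⟨⟨h1, h2⟩, h3⟩

lemma couplingKernel_sum {d N : ℕ} [NeZero N] (C O : Set ℤ) (x : Cyl d N) (a : ℤ)
    (y' : Torus d N) :
    ∑ y : Torus d N, stepsLaw d N {ξ | entrance C O x ξ = (y, a)} *
      couplingKernel C O x (y, a) y' =
      (∑ y : Torus d N, stepsLaw d N {ξ | entrance C O x ξ = (y, a)}) /
        Fintype.card (Torus d N) :=
  (exists_coupling_uniform (fun y : Torus d N => stepsLaw d N {ξ | entrance C O x ξ = (y, a)})
    fun _ => measure_ne_top _ _).choose_spec.1 y'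

lemma couplingKernel_mismatch {d N : ℕ} [NeZero N] (C O : Set ℤ) (x : Cyl d N) (a : ℤ)
    (y : Torus d N) :
    stepsLaw d N {ξ | entrance C O x ξ = (y, a)} * (1 - couplingKernel C O x (y, a) y) ≤
      stepsLaw d N {ξ | entrance C O x ξ = (y, a)} -
      (∑ y' : Torus d N, stepsLaw d N {ξ | entrance C O x ξ = (y', a)}) /
        Fintype.card (Torus d N) :=
  (exists_coupling_uniform (fun y : Torus d N => stepsLaw d N {ξ | entrance C O x ξ = (y, a)})
    fun _ => measure_ne_top _ _).choose_spec.2 y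

lemma sum_entrance_eq {d N : ℕ} [NeZero N] (C O : Set ℤ) (x : Cyl d N) (a : ℤ) :
    ∑ y : Torus d N, stepsLaw d N {ξ | entrance C O x ξ = (y, a)} =
      stepsLaw d N {ξ | (entrance C O x ξ).2 = a} := by
  rw [← measure_biUnion_finset]
  · congr 1
    ext ξ
    simp [Prod.ext_iff]
  · intro y _ y' _ hy
    refine Set.disjoint_left.2 fun ξ h1 h2 => hy ?_
    have : (y, a) = (y', a) := h1.symm.trans h2
    simpa using this
  · intro y _
    exact measurable_entrance C O x (measurableSet_singleton _)

lemma lintegral_entrance {d N : ℕ} [NeZero N] (C O : Set ℤ) (x : Cyl d N) (f : Cyl d N → ℝ≥0∞) :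
    ∫⁻ ξ, f (entrance C O x ξ) ∂stepsLaw d N =
      ∑' r, f r * stepsLaw d N {ξ | entrance C O x ξ = r} := by
  rw [← lintegral_map (f := f) Measurable.of_discrete (measurable_entrance C O x),
    lintegral_countable']
  refine tsum_congr fun r => ?_
  rw [Measure.map_apply (measurable_entrance C O x) (measurableSet_singleton r)]
  rfl

lemma lintegral_aux {d N : ℕ} [NeZero N] (C O : Set ℤ) (x r : Cyl d N) (f : Torus d N → ℝ≥0∞) :
    ∫⁻ U, f (U 0 (x, r)) ∂(Measure.infinitePi fun _ : ℕ => auxLaw d N C O) =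
      ∑ y, f y * couplingKernel C O x r y := by
  have h1 := measurePreserving_eval_infinitePi (fun _ : ℕ => auxLaw d N C O) 0
  have h2 : MeasurePreserving (Function.eval (x, r)) (auxLaw d N C O)
      (couplingKernel C O x r).toMeasure :=
    measurePreserving_eval_infinitePi
      (fun i : Cyl d N × Cyl d N => (couplingKernel C O i.1 i.2).toMeasure) (x, r)
  have h3 := (h2.comp h1).lintegral_comp (f := f) Measurable.of_discrete
  refine h3.trans ?_
  rw [lintegral_countable', tsum_fintype]
  refine Finset.sum_congr rfl fun y _ => ?_
  rw [PMF.toMeasure_apply_singleton _ _ (measurableSet_singleton y)]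

/-- The strong Markov property at the first return gives a walk restarted at the corrected point,
and averaging the kernel over entrance points at height `β.1` makes this point uniform. The start
`x` survives only in the probability of the entrance height. -/
lemma noiseLaw_excursionEvent {d N : ℕ} [NeZero N] {C O : Set ℤ} (hC : TwoSided C)
    (hO : TwoSided Oᶜ) (x : Cyl d N) (β : ℤ × ℤ) {A : Set (ℕ → Cyl d N)} (hA : MeasurableSet A) :
    noiseLaw d N C O {p | ExcursionEvent C O (path x p.1) 0 (p.2 0) β A} =
      stepsLaw d N {ξ | (entrance C O x ξ).2 = β.1} *
        walkLaw d N (levelUniform d N β.1) (stoppedSet C O β.2 A) := by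
  set S := stoppedSet C O β.2 A with hSdef
  have hS : MeasurableSet S := measurableSet_stoppedSet C O β.2 hA
  set G : Torus d N → ℝ≥0∞ := fun y => stepsLaw d N {ξ | path (y, β.1) ξ ∈ S} with hG
  have hsm := strong_markov (noiseLaw d N C O)
    -- Cutting the auxiliary sequence at 0 takes all of it from the second copy, so the correction
    -- is independent of the path up to the return.
    (fun n p => (glue n (p.1.1, p.2.1), glue 0 (p.1.2, p.2.2)))
    (fun n => measurePreserving_glue_prod (stepLaw d N) (auxLaw d N C O) n 0)
    (fun p => ret C O (vert (path x p.1)) 1) (by fun_prop)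
    (Measure.quasiMeasurePreserving_fst.ae ((ae_recurrentSteps d N).mono
      fun ξ hξ => ret_ne_top hξ hC hO x 1))
    (fun n u v => ret_one_eq_iff fun i hi => vert_path_glue_of_le x hi _)
    (H := {p | ExcursionEvent C O (path x p.1) 0 (p.2 0) β A})
    (measurableSet_excursionEvent C O (by fun_prop) 0 (by fun_prop) β hA)
    (fun u => {v | (entrance C O x u.1).2 = β.1 ∧
      path (v.2 0 (x, entrance C O x u.1), β.1) v.1 ∈ S})
    (fun n => (Measure.quasiMeasurePreserving_fst.ae (ae_recurrentSteps d N)).mono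
      fun v hv u hu => by
        have := excursionEvent_glue hC hO x hv hu (v.2 0) β A
        rw [← glue_zero (u.2, v.2)] at this
        exact this)
  rw [hsm]
  have hsec : ∀ r : Cyl d N,
      noiseLaw d N C O {v | r.2 = β.1 ∧ path (v.2 0 (x, r), β.1) v.1 ∈ S} =
        if r.2 = β.1 then ∑ y, G y * couplingKernel C O x r y else 0 := by
    intro r
    split_ifs with h
    · have hm : MeasurableSet {v : (ℕ → Cyl d N) × (ℕ → Cyl d N × Cyl d N → Torus d N) |
          path (v.2 0 (x, r), β.1) v.1 ∈ S} := by
        refine (measurable_path_prod.comp (Measurable.prodMk (Measurable.prodMk ?_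
          measurable_const) measurable_fst)) hS
        fun_prop
      simp only [h, true_and]
      rw [Measure.prod_apply_symm hm, ← lintegral_aux]
      rfl
    · simp [h]
  simp only [hsec]
  rw [lintegral_prod _ (Measurable.aemeasurable ?_)]
  · simp only [lintegral_const, measure_univ, mul_one]
    rw [lintegral_entrance C O x
      (fun r => if r.2 = β.1 then ∑ y, G y * couplingKernel C O x r y else 0),
      tsum_cyl_eq_sum β.1 _ fun r hr => by simp [hr]]
    simp only [if_true, Finset.sum_mul]
    rw [Finset.sum_comm]
    have : ∀ y', ∑ y : Torus d N, G y' * couplingKernel C O x (y, β.1) y' *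
        stepsLaw d N {ξ | entrance C O x ξ = (y, β.1)} =
        G y' * (stepsLaw d N {ξ | (entrance C O x ξ).2 = β.1} / Fintype.card (Torus d N)) := by
      intro y'
      rw [← sum_entrance_eq, ← couplingKernel_sum C O x β.1 y', Finset.mul_sum]
      refine Finset.sum_congr rfl fun y _ => ?_
      ring
    rw [Finset.sum_congr rfl fun y' _ => this y', ← Finset.sum_mul, walkLaw_apply _ hS,
      lintegral_levelUniform]
    simp only [div_eq_mul_inv]
    ring
  · exact (Measurable.of_discrete (f := fun r : Cyl d N =>
      if r.2 = β.1 then ∑ y, G y * couplingKernel C O x r y else 0)).comp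
        ((measurable_entrance C O x).comp measurable_fst)

/-- The probability that the first correction is non-trivial. -/
lemma noiseLaw_mismatch_le {d N : ℕ} [NeZero N] {C : Set ℤ} (O : Set ℤ) (hC : TwoSided C)
    {x : Cyl d N} {L : ℕ} (hL : ∀ z, |z - x.2| < L → z ∉ C) :
    noiseLaw d N C O {p | p.2 0 (x, entrance C O x p.1) ≠ (entrance C O x p.1).1} ≤
      ENNReal.ofReal ((N : ℝ) ^ d * (Real.cosh ((N : ℝ)⁻¹ * L))⁻¹) := by
  have heval : Measurable fun p : (Cyl d N × Cyl d N → Torus d N) × (Cyl d N × Cyl d N) =>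
      p.1 p.2 := measurable_from_prod_countable_left fun i => measurable_pi_apply i
  have hent : Measurable fun p : (ℕ → Cyl d N) × (ℕ → Cyl d N × Cyl d N → Torus d N) =>
      entrance C O x p.1 := (measurable_entrance C O x).comp measurable_fst
  have hval : Measurable fun p : (ℕ → Cyl d N) × (ℕ → Cyl d N × Cyl d N → Torus d N) =>
      p.2 0 (x, entrance C O x p.1) :=
    heval.comp (((measurable_pi_apply 0).comp measurable_snd).prodMk
      (measurable_const.prodMk hent))
  have hm : MeasurableSet {p : (ℕ → Cyl d N) × (ℕ → Cyl d N × Cyl d N → Torus d N) |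
      p.2 0 (x, entrance C O x p.1) ≠ (entrance C O x p.1).1} :=
    (hval.prodMk (measurable_fst.comp hent))
      (MeasurableSet.of_discrete (s := {q : Torus d N × Torus d N | q.1 ≠ q.2}))
  rw [Measure.prod_apply hm]
  have hsec : ∀ r : Cyl d N, (Measure.infinitePi fun _ : ℕ => auxLaw d N C O)
      {U | U 0 (x, r) ≠ r.1} = 1 - couplingKernel C O x r r.1 := by
    intro r
    have hmr : MeasurableSet {U : ℕ → Cyl d N × Cyl d N → Torus d N | U 0 (x, r) = r.1} :=
      (show Measurable fun U : ℕ → Cyl d N × Cyl d N → Torus d N => U 0 (x, r) by fun_prop)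
        (measurableSet_singleton r.1)
    have h1 : (Measure.infinitePi fun _ : ℕ => auxLaw d N C O) {U | U 0 (x, r) = r.1} =
        couplingKernel C O x r r.1 := by
      classical
      rw [← lintegral_indicator_one hmr]
      have := lintegral_aux C O x r (fun y => if y = r.1 then 1 else 0)
      simp only [ite_mul, one_mul, zero_mul, Finset.sum_ite_eq', Finset.mem_univ, if_true] at this
      rw [← this]
      exact lintegral_congr fun U => by simp [Set.indicator]
    rw [← h1, ← prob_compl_eq_one_sub hmr]
    rfl
  have h2 : ∀ ξ, (Measure.infinitePi fun _ : ℕ => auxLaw d N C O) (Prod.mk ξ ⁻¹'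
      {p : (ℕ → Cyl d N) × (ℕ → Cyl d N × Cyl d N → Torus d N) |
        p.2 0 (x, entrance C O x p.1) ≠ (entrance C O x p.1).1}) =
      1 - couplingKernel C O x (entrance C O x ξ) (entrance C O x ξ).1 := fun ξ => hsec (entrance C O x ξ)
  simp only [h2]
  rw [lintegral_entrance C O x (fun r => 1 - couplingKernel C O x r r.1), ENNReal.tsum_prod
    (f := fun y a => (1 - couplingKernel C O x (y, a) y) *
      stepsLaw d N {ξ | entrance C O x ξ = (y, a)}), ENNReal.tsum_comm, ENNReal.tsum_eq_iSup_sum]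
  -- There are infinitely many heights; the bound is uniform over finite sets of them and passes to
  -- the supremum.
  refine iSup_le fun A => ?_
  simp only [tsum_fintype]
  refine le_trans ?_ (ENNReal.ofReal_le_ofReal (sum_sum_abs_entrance_sub_le O hC A hL))
  rw [ENNReal.ofReal_sum_of_nonneg fun a _ => Finset.sum_nonneg fun y _ => abs_nonneg _]
  refine Finset.sum_le_sum fun a _ => ?_
  rw [ENNReal.ofReal_sum_of_nonneg fun y _ => abs_nonneg _]
  refine Finset.sum_le_sum fun y _ => ?_
  rw [mul_comm]
  refine (couplingKernel_mismatch C O x a y).trans ?_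
  refine le_trans ?_ (ENNReal.ofReal_le_ofReal (le_abs_self _))
  rw [ENNReal.ofReal_sub _ (by positivity), ofReal_measureReal, ENNReal.ofReal_div_of_pos
    (by exact_mod_cast Fintype.card_pos), ENNReal.ofReal_sum_of_nonneg fun _ _ => measureReal_nonneg]
  simp [ofReal_measureReal]

/-! ### Successive excursions -/

/-- The event belongs to the past of the first departure, as the Markov property at that time
requires. -/
lemma excursionEvent_congr {d N : ℕ} {C O : Set ℤ} {n : ℕ} {w w' : ℕ → Cyl d N}
    (h : ∀ i ≤ n, w i = w' i) (hn : dep C O (vert w) 1 = n)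
    (u : Cyl d N × Cyl d N → Torus d N) (β : ℤ × ℤ) (A : Set (ℕ → Cyl d N)) :
    ExcursionEvent C O w 0 u β A ↔ ExcursionEvent C O w' 0 u β A := by
  have hv : ∀ i ≤ n, vert w i = vert w' i := fun i hi => congrArg Prod.snd (h i hi)
  have hd : dep C O (vert w') 1 = dep C O (vert w) 1 := dep_one_congr hv hn.le
  have hr' : ret C O (vert w) 1 ≤ n := (ret_one_le_dep_one C O _).trans hn.le
  have hr : ret C O (vert w') 1 = ret C O (vert w) 1 := ret_one_congr hv hr'
  have h0 : atTime w (dep C O (vert w) 0) = atTime w' (dep C O (vert w') 0) := h 0 zero_le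
  have e1 := atTime_congr hv hr'
  have e2 := atTime_congr hv hn.le
  have e3 := atTime_congr h hr'
  have e4 := excursion_congr hv (ret C O (vert w) 1) hn.le
  have e5 := excursion_congr (w := fun m => (w m).1) (w' := fun m => (w' m).1)
    (fun i hi => congrArg Prod.fst (h i hi)) (ret C O (vert w) 1) hn.le
  have hexc : coupledExcursion C O w 0 u = coupledExcursion C O w' 0 u := by
    unfold coupledExcursion auxExcursion coupledTorus
    simp only [zero_add]
    rw [hd, hr, h0, e3, e4, e5]
  unfold ExcursionEvent
  simp only [zero_add]
  rw [hd, hr, hexc, e1, e2]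

lemma excursionEvent_succ {d N : ℕ} {C O : Set ℤ} {n : ℕ} {w : ℕ → Cyl d N}
    (hn : dep C O (vert w) 1 = n)
    (hd : ∀ k, dep C O (vert fun m => w (n + m)) k ≠ ⊤)
    (hr : ∀ k, ret C O (vert fun m => w (n + m)) k ≠ ⊤) (k : ℕ)
    (u : Cyl d N × Cyl d N → Torus d N) (β : ℤ × ℤ) (A : Set (ℕ → Cyl d N)) :
    ExcursionEvent C O w (k + 1) u β A ↔
      ExcursionEvent C O (fun m => w (n + m)) k u β A := by
  have e1 : ret C O (vert w) (k + 1 + 1) = n + ret C O (vert fun m => w (n + m)) (k + 1) :=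
    ret_succ_of_dep_one hn k
  have e2 : ∀ k, dep C O (vert w) (k + 1) = n + dep C O (vert fun m => w (n + m)) k :=
    dep_succ_of_dep_one hn
  have hexc : coupledExcursion C O w (k + 1) u =
      coupledExcursion C O (fun m => w (n + m)) k u := by
    unfold coupledExcursion auxExcursion coupledTorus
    rw [e1, e2, e2, excursion_coe_add _ _ (hr (k + 1)), excursion_coe_add _ _ (hr (k + 1)),
      atTime_coe_add _ _ (hr (k + 1)), atTime_coe_add _ _ (hd k)]
    rfl
  unfold ExcursionEvent
  rw [hexc, e1, e2, atTime_coe_add _ _ (hr (k + 1)), atTime_coe_add _ _ (hd (k + 1))]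
  rfl

/-- The correction of the excursion of `w` after its `k`-th departure is non-trivial. -/
def Mismatch {d N : ℕ} (C O : Set ℤ) (w : ℕ → Cyl d N) (k : ℕ)
    (u : Cyl d N × Cyl d N → Torus d N) : Prop :=
  u (atTime w (dep C O (vert w) k), atTime w (ret C O (vert w) (k + 1))) ≠
    (atTime w (ret C O (vert w) (k + 1))).1

lemma mismatch_succ {d N : ℕ} {C O : Set ℤ} {n : ℕ} {w : ℕ → Cyl d N}
    (hn : dep C O (vert w) 1 = n)
    (hd : ∀ k, dep C O (vert fun m => w (n + m)) k ≠ ⊤)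
    (hr : ∀ k, ret C O (vert fun m => w (n + m)) k ≠ ⊤) (k : ℕ)
    (u : Cyl d N × Cyl d N → Torus d N) :
    Mismatch C O w (k + 1) u ↔ Mismatch C O (fun m => w (n + m)) k u := by
  have e1 : ret C O (vert w) (k + 1 + 1) = n + ret C O (vert fun m => w (n + m)) (k + 1) :=
    ret_succ_of_dep_one hn k
  have e2 : dep C O (vert w) (k + 1) = n + dep C O (vert fun m => w (n + m)) k :=
    dep_succ_of_dep_one hn k
  unfold Mismatch
  rw [e1, e2, atTime_coe_add _ _ (hr (k + 1)), atTime_coe_add _ _ (hd k)]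

lemma measurableSet_mismatch {d N : ℕ} {Ω : Type*} [MeasurableSpace Ω] (C O : Set ℤ)
    {w : Ω → ℕ → Cyl d N} (hw : Measurable w) (k : ℕ) {u : Ω → Cyl d N × Cyl d N → Torus d N}
    (hu : Measurable u) : MeasurableSet {ω | Mismatch C O (w ω) k (u ω)} := by
  have hv : Measurable fun ω => vert (w ω) := measurable_vert.comp hw
  have hr : Measurable fun ω => ret C O (vert (w ω)) (k + 1) :=
    (measurable_ret C O (k + 1)).comp hv
  have hd : Measurable fun ω => dep C O (vert (w ω)) k := (measurable_dep C O k).comp hv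
  have heval : Measurable fun p : (Cyl d N × Cyl d N → Torus d N) × (Cyl d N × Cyl d N) =>
      p.1 p.2 := measurable_from_prod_countable_left fun i => measurable_pi_apply i
  have hR := measurable_atTime hw hr
  have h1 := heval.comp (hu.prodMk ((measurable_atTime hw hd).prodMk hR))
  exact (h1.prodMk (measurable_fst.comp hR))
    (MeasurableSet.of_discrete (s := {q : Torus d N × Torus d N | q.1 ≠ q.2}))

/-- The two torus paths differ by a constant translation, so they coincide as soon as they agree at
time 0. -/
lemma excursion_ne_coupledTorus_iff {d N : ℕ} (C O : Set ℤ) (w : ℕ → Cyl d N) (k : ℕ)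
    (u : Cyl d N × Cyl d N → Torus d N) :
    excursion (fun m => (w m).1) (ret C O (vert w) (k + 1)) (dep C O (vert w) (k + 1)) ≠
      coupledTorus C O w k u ↔ Mismatch C O w k u := by
  refine not_congr ⟨fun h => ?_, fun h => ?_⟩
  · have := congrFun h 0
    unfold coupledTorus at this
    rw [sub_add, eq_comm, sub_eq_self, sub_eq_zero] at this
    exact this.symm
  · ext n : 1
    unfold coupledTorus
    rw [h, sub_add_cancel]

/-- The position at the first departure time. -/
noncomputable def departure {d N : ℕ} (C O : Set ℤ) (x : Cyl d N) (ξ : ℕ → Cyl d N) : Cyl d N :=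
  atTime (path x ξ) (dep C O (vert (path x ξ)) 1)

/-- The strong Markov property at the first departure time. -/
lemma noiseLaw_markov_dep {d N : ℕ} [NeZero N] {C O : Set ℤ} (hC : TwoSided C)
    (hO : TwoSided Oᶜ) (x : Cyl d N)
    (E : (ℕ → Cyl d N) → (Cyl d N × Cyl d N → Torus d N) → Prop)
    (G G' : (ℕ → Cyl d N) → (ℕ → Cyl d N × Cyl d N → Torus d N) → Prop)
    (hE : ∀ (n : ℕ) w w' u, (∀ i ≤ n, w i = w' i) → dep C O (vert w) 1 = n → (E w u ↔ E w' u))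
    (hG : ∀ (n : ℕ) w U, dep C O (vert w) 1 = n →
      (∀ k, dep C O (vert fun m => w (n + m)) k ≠ ⊤) →
      (∀ k, ret C O (vert fun m => w (n + m)) k ≠ ⊤) →
      (G w U ↔ G' (fun m => w (n + m)) (fun j => U (j + 1))))
    (hm : MeasurableSet {p : (ℕ → Cyl d N) × (ℕ → Cyl d N × Cyl d N → Torus d N) |
      E (path x p.1) (p.2 0) ∧ G (path x p.1) p.2}) :
    noiseLaw d N C O {p | E (path x p.1) (p.2 0) ∧ G (path x p.1) p.2} =
      ∫⁻ u, noiseLaw d N C O {v | E (path x u.1) (u.2 0) ∧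
        G' (path (departure C O x u.1) v.1) v.2} ∂noiseLaw d N C O := by
  refine strong_markov (noiseLaw d N C O)
    -- The first term of the auxiliary sequence belongs to the excursion just completed; all later
    -- terms go with the future.
    (fun n p => (glue n (p.1.1, p.2.1), glue 1 (p.1.2, p.2.2)))
    (fun n => measurePreserving_glue_prod (stepLaw d N) (auxLaw d N C O) n 1)
    (fun p => dep C O (vert (path x p.1)) 1) (by fun_prop)
    (Measure.quasiMeasurePreserving_fst.ae ((ae_recurrentSteps d N).mono
      fun ξ hξ => dep_ne_top hξ hC hO x 1))
    (fun n u v => dep_one_eq_iff fun i hi => vert_path_glue_of_le x hi _) hm _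
    (fun n => (Measure.quasiMeasurePreserving_fst.ae (ae_recurrentSteps d N)).mono
      fun v hv u hu => ?_)
  set w := path x (glue n (u.1, v.1)) with hw
  have hagree : ∀ i ≤ n, path x u.1 i = w i := fun i hi => (path_glue_of_le x hi (u.1, v.1)).symm
  have hdep : dep C O (vert w) 1 = n :=
    (dep_one_eq_iff fun i hi => congrArg Prod.snd (hagree i hi)).1 hu
  have hshift : (fun m => w (n + m)) = path (departure C O x u.1) v.1 := by
    ext m : 1
    rw [hw, path_glue_add, departure, hu]
    rfl
  have hU : (fun j => glue 1 (u.2, v.2) (j + 1)) = v.2 := by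
    ext j : 1
    rw [add_comm, glue_add]
  have h1 := hE n _ _ (u.2 0) hagree hu
  have h2 := hG n w (glue 1 (u.2, v.2)) hdep (by rw [hshift]; exact dep_ne_top hv hC hO _)
    (by rw [hshift]; exact ret_ne_top hv hC hO _)
  rw [hshift, hU] at h2
  change (E w (glue 1 (u.2, v.2) 0) ∧ G w (glue 1 (u.2, v.2))) ↔
    (E (path x u.1) (u.2 0) ∧ G' (path (departure C O x u.1) v.1) v.2)
  rw [h2, h1, glue_of_lt one_pos]

/-- The product form also covers a null conditioning event: the pinned law is then the zero measure
and both sides vanish. -/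
lemma walkLaw_stoppedSet {d N : ℕ} [NeZero N] (C O : Set ℤ) (a b : ℤ) {A : Set (ℕ → Cyl d N)}
    (hA : MeasurableSet A) :
    walkLaw d N (levelUniform d N a) (stoppedSet C O b A) =
      walkLaw d N (levelUniform d N a) {x | atTime (vert x) (dep C O (vert x) 1) = b} *
        pinnedExcursionLaw d N C O a b A := by
  have hd : Measurable fun w : ℕ → Cyl d N => dep C O (vert w) 1 := by fun_prop
  have hm : MeasurableSet {x : ℕ → Cyl d N | atTime (vert x) (dep C O (vert x) 1) = b} :=
    measurable_atTime measurable_vert hd (measurableSet_singleton b)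
  have hmeas : Measurable fun x : ℕ → Cyl d N => excursion x 0 (dep C O (vert x) 1) :=
    measurable_excursion measurable_id measurable_const hd
  have hfin : walkLaw d N (levelUniform d N a)
      {x | atTime (vert x) (dep C O (vert x) 1) = b} ≠ ⊤ := by
    rw [walkLaw_apply _ hm]
    refine ne_top_of_le_ne_top ENNReal.one_ne_top ?_
    calc _ ≤ ∫⁻ _x, 1 ∂levelUniform d N a := lintegral_mono fun x => prob_le_one
      _ = 1 := by simp
  rw [pinnedExcursionLaw, Measure.map_apply hmeas hA, pinnedLaw, cond_apply hm, ← mul_assoc]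
  by_cases h0 : walkLaw d N (levelUniform d N a)
      {x | atTime (vert x) (dep C O (vert x) 1) = b} = 0
  · rw [h0, zero_mul, zero_mul]
    exact measure_mono_null (fun x hx => hx.1) h0
  · rw [ENNReal.mul_inv_cancel h0 hfin, one_mul]
    rfl

lemma entrance_snd_congr {d N : ℕ} (C O : Set ℤ) {x x' : Cyl d N} (h : x.2 = x'.2)
    (ξ : ℕ → Cyl d N) : (entrance C O x ξ).2 = (entrance C O x' ξ).2 := by
  unfold entrance
  rw [vert_atTime, vert_atTime, vert_path_congr h]

lemma measurableSet_forall_excursionEvent {d N : ℕ} {Ω : Type*} [MeasurableSpace Ω] (C O : Set ℤ)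
    {w : Ω → ℕ → Cyl d N} (hw : Measurable w) {U : Ω → ℕ → Cyl d N × Cyl d N → Torus d N}
    (hU : Measurable U) (m i : ℕ) (β : ℕ → ℤ × ℤ) {A : ℕ → Set (ℕ → Cyl d N)}
    (hA : ∀ j, MeasurableSet (A j)) :
    MeasurableSet {ω | ∀ j < m, ExcursionEvent C O (w ω) (j + i) (U ω (j + i)) (β j) (A j)} := by
  have : {ω | ∀ j < m, ExcursionEvent C O (w ω) (j + i) (U ω (j + i)) (β j) (A j)} =
      ⋂ j ∈ Finset.range m, {ω | ExcursionEvent C O (w ω) (j + i) (U ω (j + i)) (β j) (A j)} := by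
    ext ω
    simp
  rw [this]
  exact Finset.measurableSet_biInter _ fun j _ => measurableSet_excursionEvent C O hw _
    ((measurable_pi_apply _).comp hU) _ (hA j)

/-- The law of the first `m` corrected excursions. -/
lemma exists_noiseLaw_excursionEvents {d N : ℕ} [NeZero N] {C O : Set ℤ} (hC : TwoSided C)
    (hO : TwoSided Oᶜ) (m : ℕ) : ∀ β : ℕ → ℤ × ℤ, ∃ Ψ : ℤ → ℝ≥0∞,
      ∀ (A : ℕ → Set (ℕ → Cyl d N)) (_ : ∀ j, MeasurableSet (A j)) (x : Cyl d N),
        noiseLaw d N C O {p | ∀ j < m, ExcursionEvent C O (path x p.1) j (p.2 j) (β j) (A j)} =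
          Ψ x.2 * ∏ j ∈ Finset.range m, pinnedExcursionLaw d N C O (β j).1 (β j).2 (A j) := by
  induction m with
  | zero => exact fun β => ⟨fun _ => 1, fun A hA x => by simp⟩
  | succ m ih =>
    intro β
    obtain ⟨Ψ, hΨ⟩ := ih fun j => β (j + 1)
    -- The first excursion event fixes the departure height at `(β 0).2`, so the future contributes
    -- the constant `Ψ (β 0).2`. The prefactor depends on the start through its height only, which
    -- keeps the induction going, and not on `A`.
    refine ⟨fun z => stepsLaw d N {ξ | (entrance C O ((0, z) : Cyl d N) ξ).2 = (β 0).1} *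
      walkLaw d N (levelUniform d N (β 0).1)
        {x | atTime (vert x) (dep C O (vert x) 1) = (β 0).2} * Ψ (β 0).2, fun A hA x => ?_⟩
    have hset : {p : (ℕ → Cyl d N) × (ℕ → Cyl d N × Cyl d N → Torus d N) |
        ∀ j < m + 1, ExcursionEvent C O (path x p.1) j (p.2 j) (β j) (A j)} =
        {p | ExcursionEvent C O (path x p.1) 0 (p.2 0) (β 0) (A 0) ∧
          ∀ j < m, ExcursionEvent C O (path x p.1) (j + 1) (p.2 (j + 1)) (β (j + 1))
            (A (j + 1))} := by
      ext p
      exact Nat.forall_lt_succ_left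
    have hm0 : MeasurableSet {p : (ℕ → Cyl d N) × (ℕ → Cyl d N × Cyl d N → Torus d N) |
        ExcursionEvent C O (path x p.1) 0 (p.2 0) (β 0) (A 0)} :=
      measurableSet_excursionEvent C O (by fun_prop) 0 (by fun_prop) (β 0) (hA 0)
    rw [hset, noiseLaw_markov_dep hC hO x (fun w u => ExcursionEvent C O w 0 u (β 0) (A 0))
      (fun w U => ∀ j < m, ExcursionEvent C O w (j + 1) (U (j + 1)) (β (j + 1)) (A (j + 1)))
      (fun w U => ∀ j < m, ExcursionEvent C O w j (U j) (β (j + 1)) (A (j + 1)))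
      (fun n w w' u h hn => excursionEvent_congr h hn u _ _)
      (fun n w U hn hd hr => forall₂_congr fun j _ => excursionEvent_succ hn hd hr j _ _ _)
      (hm0.inter (measurableSet_forall_excursionEvent C O (by fun_prop) measurable_snd m 1
        (fun j => β (j + 1)) fun j => hA (j + 1)))]
    have hsec : ∀ u : (ℕ → Cyl d N) × (ℕ → Cyl d N × Cyl d N → Torus d N),
        noiseLaw d N C O {v | ExcursionEvent C O (path x u.1) 0 (u.2 0) (β 0) (A 0) ∧
          ∀ j < m, ExcursionEvent C O (path (departure C O x u.1) v.1) j (v.2 j) (β (j + 1))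
            (A (j + 1))} =
        {p : (ℕ → Cyl d N) × (ℕ → Cyl d N × Cyl d N → Torus d N) |
          ExcursionEvent C O (path x p.1) 0 (p.2 0) (β 0) (A 0)}.indicator
          (fun _ => Ψ (β 0).2 * ∏ j ∈ Finset.range m,
            pinnedExcursionLaw d N C O (β (j + 1)).1 (β (j + 1)).2 (A (j + 1))) u := by
      intro u
      by_cases hu : ExcursionEvent C O (path x u.1) 0 (u.2 0) (β 0) (A 0)
      · simp only [Set.indicator, Set.mem_ofPred_eq, hu, true_and, if_true]
        rw [hΨ (fun j => A (j + 1)) (fun j => hA (j + 1))]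
        have : (departure C O x u.1).2 = (β 0).2 := hu.1.2
        rw [this]
      · simp [Set.indicator, hu]
    rw [lintegral_congr hsec, lintegral_indicator_const hm0,
      noiseLaw_excursionEvent hC hO x (β 0) (hA 0), walkLaw_stoppedSet C O _ _ (hA 0),
      Finset.prod_range_succ']
    have hq : {ξ : ℕ → Cyl d N | (entrance C O x ξ).2 = (β 0).1} =
        {ξ | (entrance C O ((0, x.2) : Cyl d N) ξ).2 = (β 0).1} := by
      ext ξ
      change (entrance C O x ξ).2 = (β 0).1 ↔ (entrance C O ((0, x.2) : Cyl d N) ξ).2 = (β 0).1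
      rw [entrance_snd_congr C O (x := x) (x' := (0, x.2)) rfl ξ]
    rw [hq]
    ring

/-- The joint law of the vertical path up to the first departure and of the corrected
excursions following it. -/
lemma exists_noiseLaw_initial {d N : ℕ} [NeZero N] {C O : Set ℤ} (hC : TwoSided C)
    (hO : TwoSided Oᶜ) (m : ℕ) (β : ℕ → ℤ × ℤ) {B : Set (ℕ → ℤ)} (hB : MeasurableSet B) :
    ∃ Ψ : Cyl d N → ℝ≥0∞, ∀ (A : ℕ → Set (ℕ → Cyl d N)) (_ : ∀ j, MeasurableSet (A j))
      (x : Cyl d N),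
        noiseLaw d N C O {p | excursion (vert (path x p.1)) 0 (dep C O (vert (path x p.1)) 1) ∈ B ∧
          ∀ j < m, ExcursionEvent C O (path x p.1) (j + 1) (p.2 (j + 1)) (β j) (A j)} =
          Ψ x * ∏ j ∈ Finset.range m, pinnedExcursionLaw d N C O (β j).1 (β j).2 (A j) := by
  obtain ⟨Ψ, hΨ⟩ := exists_noiseLaw_excursionEvents (d := d) (N := N) hC hO m β
  refine ⟨fun x => ∫⁻ u, {u : (ℕ → Cyl d N) × (ℕ → Cyl d N × Cyl d N → Torus d N) |
      excursion (vert (path x u.1)) 0 (dep C O (vert (path x u.1)) 1) ∈ B}.indicator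
        (fun u => Ψ (departure C O x u.1).2) u ∂noiseLaw d N C O, fun A hA x => ?_⟩
  have hv : Measurable fun p : (ℕ → Cyl d N) × (ℕ → Cyl d N × Cyl d N → Torus d N) =>
      vert (path x p.1) := by fun_prop
  have hm0 : MeasurableSet {p : (ℕ → Cyl d N) × (ℕ → Cyl d N × Cyl d N → Torus d N) |
      excursion (vert (path x p.1)) 0 (dep C O (vert (path x p.1)) 1) ∈ B} :=
    measurable_excursion hv measurable_const ((measurable_dep C O 1).comp hv) hB
  rw [noiseLaw_markov_dep hC hO x
    (fun w _ => excursion (vert w) 0 (dep C O (vert w) 1) ∈ B)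
    (fun w U => ∀ j < m, ExcursionEvent C O w (j + 1) (U (j + 1)) (β j) (A j))
    (fun w U => ∀ j < m, ExcursionEvent C O w j (U j) (β j) (A j))
    (fun n w w' u h hn => ?_)
    (fun n w U hn hd hr => forall₂_congr fun j _ => excursionEvent_succ hn hd hr j _ _ _)
    (hm0.inter (measurableSet_forall_excursionEvent C O (by fun_prop) measurable_snd m 1 β hA))]
  · rw [← lintegral_mul_const']
    · refine lintegral_congr fun u => ?_
      by_cases hu : excursion (vert (path x u.1)) 0 (dep C O (vert (path x u.1)) 1) ∈ B
      · simp only [Set.indicator, Set.mem_ofPred_eq, hu, true_and, if_true]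
        rw [hΨ A hA]
      · simp [Set.indicator, hu]
    · refine ENNReal.prod_ne_top fun j _ => ?_
      have : pinnedExcursionLaw d N C O (β j).1 (β j).2 (A j) ≤ 1 := by
        unfold pinnedExcursionLaw pinnedLaw
        exact prob_le_one
      exact ne_top_of_le_ne_top ENNReal.one_ne_top this
  · have hvv : ∀ i ≤ n, vert w i = vert w' i := fun i hi => congrArg Prod.snd (h i hi)
    rw [dep_one_congr hvv hn.le, excursion_congr hvv 0 hn.le]

/-- The position at the first departure lies outside `O`, so a bound for such starts suffices after
one application of the Markov property. The conclusion then holds for every start, including those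
inside `O`. -/
lemma noiseLaw_mismatch_succ_le {d N : ℕ} [NeZero N] {C O : Set ℤ} (hC : TwoSided C)
    (hO : TwoSided Oᶜ) {k : ℕ} {ε : ℝ≥0∞}
    (h : ∀ x : Cyl d N, x.2 ∉ O →
      noiseLaw d N C O {p | Mismatch C O (path x p.1) k (p.2 k)} ≤ ε) (x : Cyl d N) :
    noiseLaw d N C O {p | Mismatch C O (path x p.1) (k + 1) (p.2 (k + 1))} ≤ ε := by
  have hm := measurableSet_mismatch C O
    (Ω := (ℕ → Cyl d N) × (ℕ → Cyl d N × Cyl d N → Torus d N))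
    (w := fun p => path x p.1) (by fun_prop) (k + 1) (u := fun p => p.2 (k + 1)) (by fun_prop)
  have hM := noiseLaw_markov_dep hC hO x (fun _ _ => True)
    (fun w U => Mismatch C O w (k + 1) (U (k + 1))) (fun w U => Mismatch C O w k (U k))
    (fun _ _ _ _ _ _ => Iff.rfl) (fun n w U hn hd hr => mismatch_succ hn hd hr k _)
    (by simpa only [true_and] using hm)
  simp only [true_and] at hM
  rw [hM]
  calc _ ≤ ∫⁻ _u, ε ∂noiseLaw d N C O := by
        refine lintegral_mono_ae ?_
        filter_upwards [Measure.quasiMeasurePreserving_fst.ae (ae_recurrentSteps d N)] with u hu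
        exact h _ (atTime_firstTimeFrom_mem (dep_ne_top hu hC hO x 1))
    _ = ε := by simp

lemma noiseLaw_mismatch_all_le {d N : ℕ} [NeZero N] {C O : Set ℤ} (hC : TwoSided C)
    (hO : TwoSided Oᶜ) {L : ℕ} (hL : ∀ a ∉ O, ∀ z, |z - a| < L → z ∉ C) (k : ℕ) (x : Cyl d N) :
    noiseLaw d N C O {p | Mismatch C O (path x p.1) (k + 1) (p.2 (k + 1))} ≤
      ENNReal.ofReal ((N : ℝ) ^ d * (Real.cosh ((N : ℝ)⁻¹ * L))⁻¹) := by
  suffices H : ∀ x : Cyl d N, x.2 ∉ O →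
      noiseLaw d N C O {p | Mismatch C O (path x p.1) k (p.2 k)} ≤
        ENNReal.ofReal ((N : ℝ) ^ d * (Real.cosh ((N : ℝ)⁻¹ * L))⁻¹) from
    noiseLaw_mismatch_succ_le hC hO H x
  induction k with
  | zero =>
    intro x hx
    refine le_trans (measure_mono fun p hp => ?_) (noiseLaw_mismatch_le O hC (hL x.2 hx))
    have h0 : atTime (path x p.1) (dep C O (vert (path x p.1)) 0) = x := path_zero x p.1
    have hp' : Mismatch C O (path x p.1) 0 (p.2 0) := hp
    unfold Mismatch at hp'
    rw [h0] at hp'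
    exact hp'
  | succ k ih => exact fun x _ => noiseLaw_mismatch_succ_le hC hO ih x

/-! ### Conditioning on vertical data -/

/-- For countable `T` the law of finitely many coordinates is determined by its atoms. Cylinders of
length at least `m₀` suffice, since every finite set of indices lies in a long enough initial
segment. -/
lemma measure_pi_ext_of_cylinders {T : Type*} [MeasurableSpace T] [Countable T] [Inhabited T]
    [MeasurableSingletonClass T] {μ ν : Measure (ℕ → T)} [IsFiniteMeasure μ] (m₀ : ℕ)
    (h : ∀ m, m₀ ≤ m → ∀ β : ℕ → T, μ {v | ∀ j < m, v j = β j} = ν {v | ∀ j < m, v j = β j}) :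
    μ = ν := by
  have hrange : ∀ m, m₀ ≤ m → μ.map (Finset.range m).restrict = ν.map (Finset.range m).restrict := by
    intro m hm
    refine Measure.ext_of_singleton fun f => ?_
    rw [Measure.map_apply (Finset.measurable_restrict _) (measurableSet_singleton _),
      Measure.map_apply (Finset.measurable_restrict _) (measurableSet_singleton _)]
    have : (Finset.range m).restrict (π := fun _ : ℕ => T) ⁻¹' {f} =
        {v : ℕ → T | ∀ j < m, v j = if hj : j ∈ Finset.range m then f ⟨j, hj⟩ else default} := by
      ext v
      simp only [Set.mem_preimage, Set.mem_singleton_iff, funext_iff, Set.mem_ofPred_eq]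
      constructor
      · intro hv j hj
        rw [dif_pos (Finset.mem_range.2 hj)]
        exact hv ⟨j, Finset.mem_range.2 hj⟩
      · intro hv j
        have := hv j (Finset.mem_range.1 j.2)
        rw [dif_pos j.2] at this
        exact this
    rw [this]
    exact h m hm _
  have hall : ∀ I : Finset ℕ, μ.map I.restrict = ν.map I.restrict := by
    intro I
    obtain ⟨m, hm0, hm⟩ : ∃ m, m₀ ≤ m ∧ I ⊆ Finset.range m := by
      refine ⟨max m₀ (I.sup id + 1), le_max_left _ _, fun i hi => Finset.mem_range.2 ?_⟩
      exact lt_max_of_lt_right (Nat.lt_succ_of_le (Finset.le_sup (f := id) hi))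
    have hcomp : I.restrict (π := fun _ : ℕ => T) =
        Finset.restrict₂ hm ∘ (Finset.range m).restrict := rfl
    rw [hcomp, ← Measure.map_map (Finset.measurable_restrict₂ hm) (Finset.measurable_restrict _),
      hrange m hm0, Measure.map_map (Finset.measurable_restrict₂ hm) (Finset.measurable_restrict _)]
  have hμ : IsProjectiveLimit μ fun I : Finset ℕ => μ.map I.restrict := fun I => rfl
  have hν : IsProjectiveLimit ν fun I : Finset ℕ => μ.map I.restrict := fun I => (hall I).symm
  exact hμ.unique hν

/-- The claim is that the law of `V` on `H` has density `g` with respect to the law of `V`. Both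
measures are compared on rectangles `B ×ˢ cylinder`; by `hloc`, `g` is constant on a cylinder of
length at least `m₀`, so the density integrates to a plain product there. -/
lemma condExp_indicator_of_cylinders {Ω S T : Type*} [MeasurableSpace Ω] [MeasurableSpace S]
    [MeasurableSpace T] [Countable T] [Inhabited T] [MeasurableSingletonClass T]
    (P : Measure Ω) [IsProbabilityMeasure P] {V : Ω → S × (ℕ → T)} (hV : Measurable V)
    {H : Set Ω} (hH : MeasurableSet H) {g : (ℕ → T) → ℝ} (hg : Measurable g)
    (hg0 : ∀ v, 0 ≤ g v) (hg1 : ∀ v, g v ≤ 1) (m₀ : ℕ)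
    (hloc : ∀ v v', (∀ j < m₀, v j = v' j) → g v = g v')
    (h : ∀ m, m₀ ≤ m → ∀ (B : Set S) (_ : MeasurableSet B) (β : ℕ → T),
      P (H ∩ V ⁻¹' (B ×ˢ {v | ∀ j < m, v j = β j})) =
        P (V ⁻¹' (B ×ˢ {v | ∀ j < m, v j = β j})) * ENNReal.ofReal (g β)) :
    P⟦H | MeasurableSpace.comap V inferInstance⟧ =ᵐ[P] fun ω => g (V ω).2 := by
  set ρ₁ : Measure (S × (ℕ → T)) := (P.restrict H).map V with hρ₁
  set ρ₂ : Measure (S × (ℕ → T)) :=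
    (P.map V).withDensity (fun q => ENNReal.ofReal (g q.2)) with hρ₂
  have hgm : Measurable fun q : S × (ℕ → T) => ENNReal.ofReal (g q.2) :=
    (hg.comp measurable_snd).ennreal_ofReal
  have hcyl : ∀ (m : ℕ) (β : ℕ → T), MeasurableSet {v : ℕ → T | ∀ j < m, v j = β j} := by
    intro m β
    have : {v : ℕ → T | ∀ j < m, v j = β j} =
        ⋂ j ∈ Finset.range m, (fun v : ℕ → T => v j) ⁻¹' {β j} := by
      ext v; simp
    rw [this]
    exact Finset.measurableSet_biInter _ fun j _ => measurable_pi_apply j (measurableSet_singleton _)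
  have hρ : ρ₁ = ρ₂ := by
    refine Measure.ext_prod fun {B B'} hB hB' => ?_
    have hfst : MeasurableSet ((Prod.fst : S × (ℕ → T) → S) ⁻¹' B) := measurable_fst hB
    have key : (ρ₁.restrict (Prod.fst ⁻¹' B)).map Prod.snd =
        (ρ₂.restrict (Prod.fst ⁻¹' B)).map Prod.snd := by
      refine measure_pi_ext_of_cylinders m₀ fun m hm β => ?_
      have hrect : ((Prod.snd : S × (ℕ → T) → ℕ → T) ⁻¹' {v | ∀ j < m, v j = β j}) ∩
          (Prod.fst ⁻¹' B) = B ×ˢ {v | ∀ j < m, v j = β j} := by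
        rw [Set.inter_comm]; rfl
      have hR : MeasurableSet (B ×ˢ {v : ℕ → T | ∀ j < m, v j = β j}) := hB.prod (hcyl m β)
      rw [Measure.map_apply measurable_snd (hcyl m β), Measure.map_apply measurable_snd (hcyl m β),
        Measure.restrict_apply (measurable_snd (hcyl m β)),
        Measure.restrict_apply (measurable_snd (hcyl m β)), hrect, hρ₁, hρ₂,
        Measure.map_apply hV hR, Measure.restrict_apply (hV hR), Set.inter_comm, h m hm B hB β,
        withDensity_apply _ hR]
      have hconst : ∫⁻ q in B ×ˢ {v | ∀ j < m, v j = β j}, ENNReal.ofReal (g q.2) ∂P.map V =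
          ∫⁻ _q in B ×ˢ {v | ∀ j < m, v j = β j}, ENNReal.ofReal (g β) ∂P.map V := by
        refine setLIntegral_congr_fun hR fun q hq => ?_
        have : ∀ j < m, q.2 j = β j := hq.2
        rw [hloc q.2 β fun j hj => this j (hj.trans_le hm)]
      rw [hconst, setLIntegral_const, Measure.map_apply hV hR, mul_comm]
    have e := DFunLike.congr_fun key B'
    rw [Measure.map_apply measurable_snd hB', Measure.map_apply measurable_snd hB',
      Measure.restrict_apply (measurable_snd hB'), Measure.restrict_apply (measurable_snd hB'),
      Set.inter_comm] at e
    exact e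
  have hgV : Measurable[MeasurableSpace.comap V inferInstance] fun ω => g (V ω).2 :=
    (hg.comp measurable_snd).comp (comap_measurable V)
  have hle : MeasurableSpace.comap V inferInstance ≤ (inferInstance : MeasurableSpace Ω) :=
    hV.comap_le
  have hint : Integrable (fun ω => g (V ω).2) P :=
    Integrable.of_bound (hgV.mono hle le_rfl).aestronglyMeasurable 1
      (Eventually.of_forall fun ω => by
        rw [Real.norm_of_nonneg (hg0 _)]; exact hg1 _)
  refine (ae_eq_condExp_of_forall_setIntegral_eq hle
    ((integrable_const (1 : ℝ)).indicator hH) (fun s _ _ => hint.integrableOn) ?_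
    hgV.stronglyMeasurable.aestronglyMeasurable).symm
  rintro s ⟨B, hB, rfl⟩ -
  have hs : MeasurableSet (V ⁻¹' B) := hV hB
  rw [integral_eq_lintegral_of_nonneg_ae (Eventually.of_forall fun ω => hg0 _)
    (hgV.mono hle le_rfl).aestronglyMeasurable, setIntegral_indicator hH, setIntegral_const,
    smul_eq_mul, mul_one, Measure.real]
  congr 1
  have e := DFunLike.congr_fun hρ B
  rw [hρ₁, hρ₂, Measure.map_apply hV hB, Measure.restrict_apply hs, withDensity_apply _ hB,
    setLIntegral_map hB hgm hV] at e
  exact e.symm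

/-! ### Geometry of the grid -/

lemma exists_bound_specialGrid {M : ℕ} (v : Fin M → ℝ) (z : Fin M → ℤ) :
    ∃ B : ℤ, 0 ≤ B ∧ ∀ s ∈ specialGrid v z, |s| ≤ B := by
  refine ⟨∑ i, |z i|, Finset.sum_nonneg fun _ _ => abs_nonneg _, ?_⟩
  rintro s ⟨i, ⟨j, -, rfl⟩, -⟩
  exact Finset.single_le_sum (f := fun i => |z i|) (fun _ _ => abs_nonneg _) (Finset.mem_univ j)

/-- The special points are bounded, so all sufficiently large multiples of `2 h`, of either sign,
belong to the grid. -/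
lemma twoSided_closedThickening {M : ℕ} (v : Fin M → ℝ) (z : Fin M → ℤ) {h : ℕ} (hh : 0 < h)
    (r : ℕ) : TwoSided (closedThickening (grid v z h) r) := by
  obtain ⟨B, hB0, hB⟩ := exists_bound_specialGrid v z
  have key : ∀ k : ℤ, B + 1 ≤ |k| → 2 * (h : ℤ) * k ∈ closedThickening (grid v z h) r := by
    intro k hk
    refine ⟨2 * (h : ℤ) * k, Or.inr ⟨dvd_mul_right _ _, fun s hs => ?_⟩, by simp⟩
    have h1 := hB s hs
    have h2 := abs_sub_abs_le_abs_sub (2 * (h : ℤ) * k) s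
    have h3 : |2 * (h : ℤ) * k| = 2 * h * |k| := by
      rw [abs_mul, abs_of_nonneg (by positivity)]
    have hh' : (1 : ℤ) ≤ h := by exact_mod_cast hh
    nlinarith
  intro x
  have hh' : (1 : ℤ) ≤ h := by exact_mod_cast hh
  have hx := abs_nonneg x
  have e1 : abs (B + 1 + |x|) = B + 1 + |x| := abs_of_nonneg (by linarith)
  refine ⟨⟨_, key (-(B + 1 + |x|)) (by rw [abs_neg, e1]; linarith), ?_⟩,
    ⟨_, key (B + 1 + |x|) (by rw [e1]; linarith), ?_⟩⟩
  · have := neg_abs_le x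
    nlinarith
  · have := le_abs_self x
    nlinarith

/-- Odd multiples of `h` are at distance at least `h` from every multiple of `2 h`, and far from the
special points once they are large. -/
lemma twoSided_compl_openThickening {M : ℕ} (v : Fin M → ℝ) (z : Fin M → ℤ) {h : ℕ}
    (hh : 0 < h) : TwoSided (openThickening (grid v z h) h)ᶜ := by
  obtain ⟨B, hB0, hB⟩ := exists_bound_specialGrid v z
  have hh' : (1 : ℤ) ≤ h := by exact_mod_cast hh
  have key : ∀ k : ℤ, B + 2 ≤ |k| → 2 * (h : ℤ) * k + h ∈ (openThickening (grid v z h) h)ᶜ := by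
    rintro k hk ⟨g, hg | ⟨⟨l, rfl⟩, -⟩, hlt⟩
    · have h1 := hB g hg
      have h2 := abs_sub_abs_le_abs_sub (2 * (h : ℤ) * k + h) g
      have h3 : |2 * (h : ℤ) * k| = 2 * h * |k| := by
        rw [abs_mul, abs_of_nonneg (by positivity)]
      have h4 := abs_sub_abs_le_abs_add (2 * (h : ℤ) * k) h
      rw [abs_of_nonneg (by positivity : (0 : ℤ) ≤ h)] at h4
      nlinarith
    · have h1 : 2 * (h : ℤ) * k + h - 2 * h * l = h * (2 * (k - l) + 1) := by ring
      rw [h1, abs_mul, abs_of_nonneg (by positivity : (0 : ℤ) ≤ h)] at hlt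
      have h2 : 1 ≤ |2 * (k - l) + 1| := Int.one_le_abs (by omega)
      nlinarith
  intro x
  have hx := abs_nonneg x
  have e1 : abs (B + 2 + |x|) = B + 2 + |x| := abs_of_nonneg (by linarith)
  refine ⟨⟨_, key (-(B + 2 + |x|)) (by rw [abs_neg, e1]; linarith), ?_⟩,
    ⟨_, key (B + 2 + |x|) (by rw [e1]; linarith), ?_⟩⟩
  · have := neg_abs_le x
    nlinarith
  · have := le_abs_self x
    nlinarith

lemma notMem_closedThickening_of_notMem_openThickening {G : Set ℤ} {h r : ℕ} (hr : r ≤ h) {a : ℤ}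
    (ha : a ∉ openThickening G h) {z : ℤ} (hz : |z - a| < (h - r : ℕ)) :
    z ∉ closedThickening G r := by
  rintro ⟨g, hg, hzg⟩
  refine ha ⟨g, hg, ?_⟩
  have h1 : |a - g| ≤ |z - a| + |z - g| := by
    rw [abs_sub_comm z a]; exact abs_sub_le a z g
  push_cast [hr] at hz
  linarith

/-- With `l = log N`, the exponent is at least `l² / 2 ≥ (4 d + 1) l ≥ 4 d l + log 2`. The `log 2`
absorbs the factor `1 / 2` in `cosh`, so `cosh` is at least `N ^ (4 d)`, of which `N ^ d` pays for
the number of characters. -/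
lemma pow_mul_inv_cosh_le {d N h δ : ℕ} (hN : 2 ≤ N) (hlog : 8 * (d : ℝ) + 2 ≤ Real.log N)
    (hh : (N : ℝ) * Real.log N ^ 2 ≤ h) (hδ : (δ : ℝ) ≤ h / 2) :
    (N : ℝ) ^ d * (Real.cosh ((N : ℝ)⁻¹ * ((h - δ : ℕ) : ℝ)))⁻¹ ≤ 1 / (N : ℝ) ^ (3 * d) := by
  have hN0 : (0 : ℝ) < N := by positivity
  have hle : δ ≤ h := by
    have : (δ : ℝ) ≤ h := hδ.trans (by have : (0 : ℝ) ≤ h := by positivity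
                                       linarith)
    exact_mod_cast this
  set l := Real.log N with hl
  set t := (N : ℝ)⁻¹ * ((h - δ : ℕ) : ℝ) with ht
  have ht1 : l ^ 2 / 2 ≤ t := by
    rw [ht, Nat.cast_sub hle, inv_mul_eq_div, le_div_iff₀ hN0]
    linarith
  have hl2 : Real.log 2 ≤ l := Real.log_le_log (by norm_num) (by exact_mod_cast hN)
  have hexp : (2 : ℝ) * (N : ℝ) ^ (4 * d) ≤ Real.exp t := by
    have e1 : (N : ℝ) ^ (4 * d) = Real.exp (4 * d * l) := by
      rw [show (4 : ℝ) * d * l = ((4 * d : ℕ) : ℝ) * l by push_cast; ring, Real.exp_nat_mul, hl,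
        Real.exp_log hN0]
    have e2 : (2 : ℝ) = Real.exp (Real.log 2) := (Real.exp_log (by norm_num)).symm
    rw [e1, e2, ← Real.exp_add, Real.exp_le_exp]
    have hd0 : (0 : ℝ) ≤ d := by positivity
    nlinarith
  have hcosh : (N : ℝ) ^ (4 * d) ≤ Real.cosh t := by
    have := Real.exp_pos (-t)
    rw [Real.cosh_eq]
    linarith
  have hpos : (0 : ℝ) < (N : ℝ) ^ (4 * d) := by positivity
  calc (N : ℝ) ^ d * (Real.cosh t)⁻¹ ≤ (N : ℝ) ^ d * ((N : ℝ) ^ (4 * d))⁻¹ := by gcongr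
    _ = 1 / (N : ℝ) ^ (3 * d) := by
        rw [show 4 * d = d + 3 * d by ring, pow_add]
        field_simp

/-! ### The coupling -/

/-- The law of the starting point, of the steps and of the auxiliary randomness. -/
noncomputable abbrev couplingLaw (d N : ℕ) [NeZero N] (C O : Set ℤ) :
    Measure (Cyl d N × ((ℕ → Cyl d N) × (ℕ → Cyl d N × Cyl d N → Torus d N))) :=
  (levelUniform d N 0).prod (noiseLaw d N C O)

lemma map_path_couplingLaw (d N : ℕ) [NeZero N] (C O : Set ℤ) :
    (couplingLaw d N C O).map (fun ω => path ω.1 ω.2.1) = walkLaw d N (levelUniform d N 0) := by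
  have h := (MeasurePreserving.id (levelUniform d N 0)).prod
    (measurePreserving_fst (μ := stepsLaw d N)
      (ν := Measure.infinitePi fun _ : ℕ => auxLaw d N C O))
  change _ = Measure.map (fun p : Cyl d N × (ℕ → Cyl d N) => path p.1 p.2)
    ((levelUniform d N 0).prod (stepsLaw d N))
  rw [← h.map_eq, Measure.map_map measurable_path_prod h.measurable]
  rfl

instance pinnedExcursionLaw_isZeroOrProbabilityMeasure (d N : ℕ) (C O : Set ℤ) (a b : ℤ) :
    IsZeroOrProbabilityMeasure (pinnedExcursionLaw d N C O a b) := by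
  unfold pinnedExcursionLaw pinnedLaw
  infer_instance

lemma measure_eq_univ_mul {α : Type*} [MeasurableSpace α] (μ : Measure α)
    [IsZeroOrProbabilityMeasure μ] (A : Set α) : μ A = μ Set.univ * μ A := by
  rcases eq_zero_or_isProbabilityMeasure μ with h | h
  · simp [h]
  · simp

/-- Untested excursions enter through the total mass of their pinned law, which is 0 or 1; being
idempotent, the masses can be factored out for all indices at once. Position `j` in the vertical
data belongs to excursion `j + 2`. -/
lemma prod_pinned_eq {d N : ℕ} (C O : Set ℤ) (S : Finset ℕ) (hS : ∀ k ∈ S, 2 ≤ k)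
    (A : ℕ → Set (ℕ → Cyl d N)) {m : ℕ} (hm : ∀ k ∈ S, k < m + 2) (β : ℕ → ℤ × ℤ) :
    ∏ j ∈ Finset.range m, pinnedExcursionLaw d N C O (β j).1 (β j).2
        (if j + 2 ∈ S then A (j + 2) else Set.univ) =
      (∏ j ∈ Finset.range m, pinnedExcursionLaw d N C O (β j).1 (β j).2 Set.univ) *
        ∏ k ∈ S, pinnedExcursionLaw d N C O (β (k - 2)).1 (β (k - 2)).2 (A k) := by
  have h1 : ∏ k ∈ S, pinnedExcursionLaw d N C O (β (k - 2)).1 (β (k - 2)).2 (A k) =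
      ∏ j ∈ Finset.range m, if j + 2 ∈ S then
        pinnedExcursionLaw d N C O (β j).1 (β j).2 (A (j + 2)) else 1 := by
    rw [← Finset.prod_filter]
    refine Finset.prod_nbij' (fun k => k - 2) (fun j => j + 2) ?_ ?_ ?_ ?_ ?_
    · intro k hk
      have h2 := hS k hk
      have h3 := hm k hk
      rw [Finset.mem_filter, Finset.mem_range, Nat.sub_add_cancel h2]
      exact ⟨by omega, hk⟩
    · intro j hj
      exact (Finset.mem_filter.1 hj).2
    · intro k hk
      exact Nat.sub_add_cancel (hS k hk)
    · intro j _
      exact Nat.add_sub_cancel j 2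
    · intro k hk
      rw [Nat.sub_add_cancel (hS k hk)]
  rw [h1, ← Finset.prod_mul_distrib]
  refine Finset.prod_congr rfl fun j _ => ?_
  split_ifs
  · exact measure_eq_univ_mul _ _
  · rw [mul_one]

/-- The product formula is used twice for the same vertical cylinder: with the events `A k` for `k ∈
S`, and with no constraint on the excursions. The prefactor `∫ Ψ` is common to both, so the two
differ exactly by the product of pinned probabilities. -/
lemma couplingLaw_condExp {d N : ℕ} [NeZero N] {C O : Set ℤ} (hC : TwoSided C)
    (hO : TwoSided Oᶜ) (S : Finset ℕ) (hS : ∀ k ∈ S, 2 ≤ k) (A : ℕ → Set (ℕ → Cyl d N))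
    (hA : ∀ k, MeasurableSet (A k)) :
    (couplingLaw d N C O)⟦⋂ k ∈ S, {ω | coupledExcursion C O (path ω.1 ω.2.1) (k - 1)
          (ω.2.2 (k - 1)) ∈ A k} |
        MeasurableSpace.comap (fun ω => verticalData C O (vert (path ω.1 ω.2.1))) inferInstance⟧
      =ᵐ[couplingLaw d N C O] fun ω => ∏ k ∈ S,
        (pinnedExcursionLaw d N C O
          (atTime (vert (path ω.1 ω.2.1)) (ret C O (vert (path ω.1 ω.2.1)) k))
          (atTime (vert (path ω.1 ω.2.1)) (dep C O (vert (path ω.1 ω.2.1)) k))).real (A k) := by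
  set g : (ℕ → ℤ × ℤ) → ℝ := fun β => ∏ k ∈ S,
    (pinnedExcursionLaw d N C O (β (k - 2)).1 (β (k - 2)).2).real (A k) with hg
  have hpath : Measurable
      fun ω : Cyl d N × ((ℕ → Cyl d N) × (ℕ → Cyl d N × Cyl d N → Torus d N)) =>
        path ω.1 ω.2.1 :=
    measurable_path_prod.comp (measurable_fst.prodMk (measurable_fst.comp measurable_snd))
  have hU : Measurable
      fun ω : Cyl d N × ((ℕ → Cyl d N) × (ℕ → Cyl d N × Cyl d N → Torus d N)) => ω.2.2 :=
    measurable_snd.comp measurable_snd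
  have hV : Measurable
      fun ω : Cyl d N × ((ℕ → Cyl d N) × (ℕ → Cyl d N × Cyl d N → Torus d N)) =>
        verticalData C O (vert (path ω.1 ω.2.1)) := by
    have hv := measurable_vert.comp hpath
    refine (measurable_excursion hv measurable_const ((measurable_dep C O 1).comp hv)).prodMk ?_
    exact measurable_pi_lambda _ fun j =>
      (measurable_atTime hv ((measurable_ret C O (j + 2)).comp hv)).prodMk
        (measurable_atTime hv ((measurable_dep C O (j + 2)).comp hv))
  have hrhs : (fun ω : Cyl d N × ((ℕ → Cyl d N) × (ℕ → Cyl d N × Cyl d N → Torus d N)) =>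
      ∏ k ∈ S, (pinnedExcursionLaw d N C O
          (atTime (vert (path ω.1 ω.2.1)) (ret C O (vert (path ω.1 ω.2.1)) k))
          (atTime (vert (path ω.1 ω.2.1)) (dep C O (vert (path ω.1 ω.2.1)) k))).real (A k)) =
      fun ω => g (verticalData C O (vert (path ω.1 ω.2.1))).2 := by
    ext ω
    refine Finset.prod_congr rfl fun k hk => ?_
    simp only [verticalData]
    rw [Nat.sub_add_cancel (hS k hk)]
  rw [hrhs]
  -- Cylinders of length `S.sup id` contain every position `k - 2` with `k ∈ S`, so they determine
  -- `g`.
  refine condExp_indicator_of_cylinders _ hV ?_ ?_ ?_ ?_ (S.sup id) ?_ ?_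
  · exact Finset.measurableSet_biInter _ fun k _ =>
      measurable_coupledExcursion C O hpath _ ((measurable_pi_apply _).comp hU) (hA k)
  · refine Finset.measurable_prod _ fun k _ => ?_
    exact (Measurable.of_discrete (f := fun b : ℤ × ℤ =>
      (pinnedExcursionLaw d N C O b.1 b.2).real (A k))).comp (measurable_pi_apply (k - 2))
  · exact fun v => Finset.prod_nonneg fun k _ => measureReal_nonneg
  · exact fun v => Finset.prod_le_one (fun k _ => measureReal_nonneg) fun k _ => measureReal_le_one
  · intro v v' hvv
    refine Finset.prod_congr rfl fun k hk => ?_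
    have h1 : k ≤ S.sup id := Finset.le_sup (f := id) hk
    have h2 := hS k hk
    rw [hvv (k - 2) (by omega)]
  · intro m hm B hB β
    obtain ⟨Ψ, hΨ⟩ := exists_noiseLaw_initial (d := d) (N := N) hC hO m β hB
    have hmS : ∀ k ∈ S, k < m + 2 := fun k hk => by
      have h1 : k ≤ S.sup id := Finset.le_sup (f := id) hk
      omega
    have hlaw : ∀ A' : ℕ → Set (ℕ → Cyl d N), (∀ j, MeasurableSet (A' j)) →
        couplingLaw d N C O {ω | excursion (vert (path ω.1 ω.2.1)) 0
          (dep C O (vert (path ω.1 ω.2.1)) 1) ∈ B ∧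
          ∀ j < m, ExcursionEvent C O (path ω.1 ω.2.1) (j + 1) (ω.2.2 (j + 1)) (β j) (A' j)} =
          (∫⁻ x, Ψ x ∂levelUniform d N 0) *
            ∏ j ∈ Finset.range m, pinnedExcursionLaw d N C O (β j).1 (β j).2 (A' j) := by
      intro A' hA'
      have hv := measurable_vert.comp hpath
      have hm1 := (measurable_excursion hv (measurable_const (a := 0))
        ((measurable_dep C O 1).comp hv)) hB
      have hm2 := measurableSet_forall_excursionEvent C O hpath hU m 1 β hA'
      refine (Measure.prod_apply (hm1.inter hm2)).trans ?_
      rw [← lintegral_mul_const _ Measurable.of_discrete]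
      exact lintegral_congr fun x => hΨ A' hA' x
    have h1 : (⋂ k ∈ S, {ω : Cyl d N × ((ℕ → Cyl d N) × (ℕ → Cyl d N × Cyl d N → Torus d N)) |
        coupledExcursion C O (path ω.1 ω.2.1) (k - 1) (ω.2.2 (k - 1)) ∈ A k}) ∩
        (fun ω => verticalData C O (vert (path ω.1 ω.2.1))) ⁻¹'
          (B ×ˢ {v | ∀ j < m, v j = β j}) =
        {ω | excursion (vert (path ω.1 ω.2.1)) 0 (dep C O (vert (path ω.1 ω.2.1)) 1) ∈ B ∧
          ∀ j < m, ExcursionEvent C O (path ω.1 ω.2.1) (j + 1) (ω.2.2 (j + 1)) (β j)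
            (if j + 2 ∈ S then A (j + 2) else Set.univ)} := by
      ext ω
      simp only [Set.mem_inter_iff, Set.mem_iInter, Set.mem_preimage, Set.mem_prod,
        Set.mem_ofPred_eq, verticalData, Prod.ext_iff, ExcursionEvent]
      constructor
      · rintro ⟨h2, h3, h4⟩
        refine ⟨h3, fun j hj => ⟨h4 j hj, ?_⟩⟩
        split_ifs with hjS
        · exact h2 (j + 2) hjS
        · trivial
      · rintro ⟨h3, h4⟩
        refine ⟨fun k hk => ?_, h3, fun j hj => (h4 j hj).1⟩
        obtain ⟨j, rfl⟩ := Nat.exists_eq_add_of_le' (hS k hk)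
        have h5 := (h4 j (by have := hmS _ hk; omega)).2
        rw [if_pos hk] at h5
        exact h5
    have h2 : (fun ω : Cyl d N × ((ℕ → Cyl d N) × (ℕ → Cyl d N × Cyl d N → Torus d N)) =>
          verticalData C O (vert (path ω.1 ω.2.1))) ⁻¹' (B ×ˢ {v | ∀ j < m, v j = β j}) =
        {ω | excursion (vert (path ω.1 ω.2.1)) 0 (dep C O (vert (path ω.1 ω.2.1)) 1) ∈ B ∧
          ∀ j < m, ExcursionEvent C O (path ω.1 ω.2.1) (j + 1) (ω.2.2 (j + 1)) (β j)
            Set.univ} := by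
      ext ω
      simp only [Set.mem_preimage, Set.mem_prod, Set.mem_ofPred_eq, verticalData, Prod.ext_iff,
        ExcursionEvent, Set.mem_univ, and_true]
    have hprod : ENNReal.ofReal (g β) =
        ∏ k ∈ S, pinnedExcursionLaw d N C O (β (k - 2)).1 (β (k - 2)).2 (A k) := by
      rw [hg, ENNReal.ofReal_prod_of_nonneg fun k _ => measureReal_nonneg]
      exact Finset.prod_congr rfl fun k _ => ofReal_measureReal
    rw [h1, h2, hlaw _ fun j => ?_, hlaw _ fun j => MeasurableSet.univ,
      prod_pinned_eq C O S hS A hmS β, hprod, mul_assoc]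
    split_ifs
    · exact hA _
    · exact MeasurableSet.univ

lemma couplingLaw_mismatch_le {d N : ℕ} [NeZero N] {C O : Set ℤ} (hC : TwoSided C)
    (hO : TwoSided Oᶜ) {L : ℕ} (hL : ∀ a ∉ O, ∀ z, |z - a| < L → z ∉ C) (k : ℕ) :
    couplingLaw d N C O {ω | Mismatch C O (path ω.1 ω.2.1) (k + 1) (ω.2.2 (k + 1))} ≤
      ENNReal.ofReal ((N : ℝ) ^ d * (Real.cosh ((N : ℝ)⁻¹ * L))⁻¹) := by
  have hpath : Measurable
      fun ω : Cyl d N × ((ℕ → Cyl d N) × (ℕ → Cyl d N × Cyl d N → Torus d N)) =>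
        path ω.1 ω.2.1 :=
    measurable_path_prod.comp (measurable_fst.prodMk (measurable_fst.comp measurable_snd))
  rw [Measure.prod_apply (measurableSet_mismatch C O hpath (k + 1) (by fun_prop))]
  calc _ ≤ ∫⁻ _x, ENNReal.ofReal ((N : ℝ) ^ d * (Real.cosh ((N : ℝ)⁻¹ * L))⁻¹)
          ∂levelUniform d N 0 :=
        lintegral_mono fun x => noiseLaw_mismatch_all_le hC hO hL k x
    _ = _ := by simp

end CylinderWalk

/-! ### The theorem -/

theorem proposition3p3 (d : ℕ) (hd : 2 ≤ d) :
    ∃ c : ℝ, 0 < c ∧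
      ∀ (M : ℕ) (_ : 1 ≤ M)
        -- heights of the special points and their limits on the scale `N ^ d`
        (z : ℕ → Fin M → ℤ) (v : Fin M → ℝ)
        (_ : ∀ i, Tendsto (fun N : ℕ => (z N i : ℝ) / (N : ℝ) ^ d) atTop (𝓝 (v i)))
        -- the scales `h_N` and `d_N`
        (h δ : ℕ → ℕ)
        (_ : Tendsto h atTop atTop) (_ : Tendsto δ atTop atTop)
        (_ : (fun N : ℕ => (h N : ℝ)) =o[atTop] fun N : ℕ => (N : ℝ) ^ d)
        (_ : ∀ᶠ N : ℕ in atTop, (N : ℝ) * Real.log N ^ 2 ≤ h N)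
        (_ : (fun N : ℕ => (δ N : ℝ)) =o[atTop] fun N : ℕ => (h N : ℝ))
        (_ : ∀ i j, v i = v j →
          (fun N : ℕ => 1 + |(z N i : ℝ) - (z N j : ℝ)|) =o[atTop] fun N : ℕ => (δ N : ℝ)),
      ∀ᶠ N : ℕ in atTop, ∀ C O : Set ℤ,
        C = closedThickening (grid v (z N) (h N)) (δ N) →
        O = openThickening (grid v (z N) (h N)) (h N) →
        ∃ (Ω : Type) (_ : MeasurableSpace Ω) (P : Measure Ω) (_ : IsProbabilityMeasure P)
          (Z : Ω → ℕ → ℤ) (Y : Ω → ℕ → Torus d N) (Y' : ℕ → Ω → ℕ → Torus d N),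
          Measurable Z ∧ Measurable Y ∧ (∀ k, 2 ≤ k → Measurable (Y' k)) ∧
          -- `X = (Y, Z)` is simple random walk started uniformly on level zero
          P.map (fun ω n => ((Y ω n, Z ω n) : Cyl d N)) = walkLaw d N (levelUniform d N 0) ∧
          -- conditional independence and conditional laws given the vertical data
          (∀ (S : Finset ℕ) (_ : ∀ k ∈ S, 2 ≤ k) (A : ℕ → Set (ℕ → Cyl d N))
            (_ : ∀ k, MeasurableSet (A k)),
            P⟦⋂ k ∈ S, {ω | auxExcursion C O k (Y' k ω) (Z ω) ∈ A k} |
                MeasurableSpace.comap (fun ω => verticalData C O (Z ω)) inferInstance⟧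
              =ᵐ[P] fun ω => ∏ k ∈ S,
                (pinnedExcursionLaw d N C O (atTime (Z ω) (ret C O (Z ω) k))
                  (atTime (Z ω) (dep C O (Z ω) k))).real (A k)) ∧
          -- each auxiliary excursion is close to the true one
          (∀ k, 2 ≤ k →
            P.real {ω | excursion (Y ω) (ret C O (Z ω) k) (dep C O (Z ω) k) ≠ Y' k ω}
              ≤ c / (N : ℝ) ^ (3 * d)) := by
  refine ⟨1, one_pos, fun M _ z v _ h δ hh _ _ hlog hδ _ => ?_⟩
  -- This threshold lets the quadratic exponent `(log N)² / 2` beat `4 d log N + log 2`.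
  have hlogN : ∀ᶠ N : ℕ in atTop, 8 * (d : ℝ) + 2 ≤ Real.log N :=
    (Real.tendsto_log_atTop.comp tendsto_natCast_atTop_atTop).eventually_ge_atTop _
  filter_upwards [hlog, hδ.def (by norm_num : (0 : ℝ) < 1 / 2), hlogN, eventually_ge_atTop 2,
    hh.eventually_ge_atTop 1] with N hlogN hδN hN hN2 hh1
  rintro C O rfl rfl
  have : NeZero N := ⟨by omega⟩
  have hδh : (δ N : ℝ) ≤ h N / 2 := by
    rw [Real.norm_of_nonneg (by positivity), Real.norm_of_nonneg (by positivity)] at hδN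
    linarith
  have hδle : δ N ≤ h N := by
    have h0 : (0 : ℝ) ≤ h N := by positivity
    have : (δ N : ℝ) ≤ h N := by linarith
    exact_mod_cast this
  set C := closedThickening (grid v (z N) (h N)) (δ N) with hCdef
  set O := openThickening (grid v (z N) (h N)) (h N) with hOdef
  have hC : TwoSided C := twoSided_closedThickening v (z N) hh1 (δ N)
  have hO : TwoSided Oᶜ := twoSided_compl_openThickening v (z N) hh1
  have hpath : Measurable
      fun ω : Cyl d N × ((ℕ → Cyl d N) × (ℕ → Cyl d N × Cyl d N → Torus d N)) =>
        path ω.1 ω.2.1 :=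
    measurable_path_prod.comp (measurable_fst.prodMk (measurable_fst.comp measurable_snd))
  refine ⟨Cyl d N × ((ℕ → Cyl d N) × (ℕ → Cyl d N × Cyl d N → Torus d N)), inferInstance,
    couplingLaw d N C O, inferInstance, fun ω => vert (path ω.1 ω.2.1),
    fun ω n => (path ω.1 ω.2.1 n).1,
    -- Corrections are numbered by the departure that precedes them, so excursion `k` uses number `k
    -- - 1`.
    fun k ω => coupledTorus C O (path ω.1 ω.2.1) (k - 1) (ω.2.2 (k - 1)),
    measurable_vert.comp hpath,
    measurable_pi_lambda _ fun n => measurable_fst.comp ((measurable_pi_apply n).comp hpath),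
    fun k _ => measurable_coupledTorus C O hpath _ (by fun_prop),
    map_path_couplingLaw d N C O, fun S hS A hA => ?_, fun k hk => ?_⟩
  · have hset : (⋂ k ∈ S, {ω : Cyl d N × ((ℕ → Cyl d N) × (ℕ → Cyl d N × Cyl d N → Torus d N)) |
        auxExcursion C O k (coupledTorus C O (path ω.1 ω.2.1) (k - 1) (ω.2.2 (k - 1)))
          (vert (path ω.1 ω.2.1)) ∈ A k}) =
        ⋂ k ∈ S, {ω | coupledExcursion C O (path ω.1 ω.2.1) (k - 1) (ω.2.2 (k - 1)) ∈ A k} := by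
      refine Set.iInter₂_congr fun k hk => ?_
      unfold coupledExcursion
      rw [Nat.sub_add_cancel (one_le_two.trans (hS k hk))]
    rw [hset]
    exact couplingLaw_condExp hC hO S hS A hA
  · obtain ⟨j, rfl⟩ := Nat.exists_eq_add_of_le' hk
    have hset : {ω : Cyl d N × ((ℕ → Cyl d N) × (ℕ → Cyl d N × Cyl d N → Torus d N)) |
        excursion (fun n => (path ω.1 ω.2.1 n).1) (ret C O (vert (path ω.1 ω.2.1)) (j + 2))
          (dep C O (vert (path ω.1 ω.2.1)) (j + 2)) ≠
          coupledTorus C O (path ω.1 ω.2.1) (j + 2 - 1) (ω.2.2 (j + 2 - 1))} =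
        {ω | Mismatch C O (path ω.1 ω.2.1) (j + 1) (ω.2.2 (j + 1))} := by
      ext ω
      exact excursion_ne_coupledTorus_iff C O (path ω.1 ω.2.1) (j + 1) (ω.2.2 (j + 1))
    rw [hset]
    -- Here `L = h N - δ N`: every point closer than this to a point outside `O` is outside `C`.
    refine (ENNReal.toReal_le_of_le_ofReal (by positivity)
      (couplingLaw_mismatch_le hC hO (L := h N - δ N)
        (fun a ha z' hz' => notMem_closedThickening_of_notMem_openThickening hδle ha hz')
        j)).trans ?_
    exact pow_mul_inv_cosh_le hN2 hN hlogN hδh
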